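/- Let $r\in\{1,-1\}$, and let $d\ge 3$ and $n>1$ be integers with $\gcd(n,d)=1$ and $n\equiv -r\pmod d$. Let $a,b,q$ be independent indeterminates. Write $(x;q)_k=\prod_{i=0}^{k-1}(1-xq^i)$, $(x_1,\dots,x_m;q)_k=(x_1;q)_k\cdots(x_m;q)_k$, $[m]=\frac{1-q^m}{1-q}$ for $m\in\mathbb{Z}$, and let $\Phi_n(q)$ be the $n$-th cyclotomic polynomial. Then, for $M=(dn-n-r)/d$ and for $M=n-1$, $$\sum_{k=0}^{M}[2dk+r]\,\frac{(aq^r,\,q^r/a,\,bq^r,\,q^r/b,\,q^r,\,q^r;\,q^d)_k}{(aq^d,\,q^d/a,\,bq^d,\,q^d/b,\,q^d,\,q^d;\,q^d)_k}\,q^{(2d-3r)k}\equiv 0\pmod{[n]\Phi_n(q)}.$$ Here a rational function of $q$ with coefficients in $\mathbb{Q}(a,b)$ is congruent to $0$ modulo a polynomial $P(q)$ if, when it is written in lowest terms, its numerator is divisible by $P(q)$ in $\mathbb{Q}(a,b)[q]$. -/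

import Mathlib

open scoped Polynomial

/-- The field `ℚ(a, b)` of rational functions in two independent indeterminates `a`, `b`. -/
abbrev CoeffField : Type := FractionRing (MvPolynomial (Fin 2) ℚ)

/-- The field `ℚ(a, b)(q)` of rational functions in `q` over `ℚ(a, b)`. -/
abbrev RatField : Type := RatFunc CoeffField

namespace RatField

/-- The indeterminate `a`. -/
noncomputable def a : RatField :=
  RatFunc.C (algebraMap (MvPolynomial (Fin 2) ℚ) CoeffField (MvPolynomial.X 0))

/-- The indeterminate `b`. -/
noncomputable def b : RatField :=
  RatFunc.C (algebraMap (MvPolynomial (Fin 2) ℚ) CoeffField (MvPolynomial.X 1))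

/-- The indeterminate `q`. -/
noncomputable def q : RatField := RatFunc.X

end RatField

/-- The `q`-shifted factorial `(x; q)_k = (1 - x)(1 - x q) ⋯ (1 - x q ^ (k - 1))`. -/
def qPoch {K : Type*} [Field K] (x q : K) (k : ℕ) : K :=
  ∏ i ∈ Finset.range k, (1 - x * q ^ i)

/-- The shortened notation `(x₁, …, x_m; q)_k = (x₁; q)_k ⋯ (x_m; q)_k`. -/
def qPochs {K : Type*} [Field K] (xs : List K) (q : K) (k : ℕ) : K :=
  (xs.map fun x => qPoch x q k).prod

/-- The `q`-integer `[m] = (1 - q ^ m) / (1 - q)` of an integer `m` (possibly negative). -/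
def qInt {K : Type*} [Field K] (q : K) (m : ℤ) : K :=
  (1 - q ^ m) / (1 - q)

/-- The polynomial `[n] = 1 + q + ⋯ + q ^ (n - 1)`. -/
noncomputable def qIntPoly (K : Type*) [Field K] (n : ℕ) : K[X] :=
  ∑ i ∈ Finset.range n, Polynomial.X ^ i

/-- Congruence `A ≡ B (mod P)` of rational functions in `q` modulo a polynomial `P` in `q`:
the numerator of `A - B`, written in lowest terms, is divisible by `P`. -/
def RatCongr {K : Type*} [Field K] (P : K[X]) (A B : RatFunc K) : Prop :=
  P ∣ (A - B).num

/-- The two notations for `[n]` agree. -/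
theorem qIntPoly_eq_qInt (n : ℕ) :
    algebraMap CoeffField[X] RatField (qIntPoly CoeffField n) = qInt RatField.q n := by
  have h : (1 : RatField) - RatField.q ≠ 0 := by
    intro h0
    have h1 : algebraMap CoeffField[X] (RatFunc CoeffField) 1
        = algebraMap CoeffField[X] (RatFunc CoeffField) Polynomial.X := by
      rw [map_one, RatFunc.algebraMap_X]; exact sub_eq_zero.mp h0
    have h2 := congrArg (Polynomial.coeff · 1) (RatFunc.algebraMap_injective CoeffField h1)
    simp [Polynomial.coeff_one] at h2
  rw [qInt, eq_div_iff h, qIntPoly, map_sum]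
  simp only [map_pow, RatFunc.algebraMap_X, zpow_natCast]
  exact geom_sum_mul_neg _ _

/-- A rational function `N / D` is congruent to `0` modulo `P` exactly as expected when the
denominator `D` is coprime to `P`. -/
theorem ratCongr_zero_iff {K : Type*} [Field K] (P N D : K[X]) (hD : D ≠ 0)
    (h : IsCoprime P D) :
    RatCongr P (algebraMap K[X] (RatFunc K) N / algebraMap K[X] (RatFunc K) D) 0 ↔ P ∣ N := by
  unfold RatCongr
  rw [sub_zero]
  set f := algebraMap K[X] (RatFunc K) N / algebraMap K[X] (RatFunc K) D with hf
  have hD' : algebraMap K[X] (RatFunc K) D ≠ 0 := RatFunc.algebraMap_ne_zero hD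
  have hd' : algebraMap K[X] (RatFunc K) f.denom ≠ 0 :=
    RatFunc.algebraMap_ne_zero (RatFunc.denom_ne_zero f)
  have e : f.num * D = N * f.denom := by
    apply RatFunc.algebraMap_injective K
    rw [map_mul, map_mul, ← div_eq_div_iff hd' hD', RatFunc.num_div_denom f]
  constructor
  · intro hp
    have hc : IsCoprime P f.denom := (RatFunc.isCoprime_num_denom f).of_isCoprime_of_dvd_left hp
    exact hc.dvd_of_dvd_mul_right (e ▸ hp.mul_right D)
  · intro hp
    exact h.dvd_of_dvd_mul_right (e ▸ hp.mul_right f.denom)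

/-! Fix a divisor m > 1 of n and let O be the ring of rational functions with denominator coprime to
Φ_m, in which q reduces to a primitive m-th root of unity. With A = q^r and Q = q^d the summand is,
up to 1/(1 - q), a very-well-poised term with numerator parameters c q^r and q^r/c for c = a, b, 1.
If A Q^M ≡ 1 modulo 1 - q^m, the reflection k ↦ M - k changes the sign of the term modulo 1 - q^m
(`wpTerm_add_reflect_mem`), so the sum up to M vanishes. Between M and m the parameter c = 1 kills
the terms, and later blocks of m terms are multiples of the first one. This gives Φ_m for every
proper divisor m (`sum_wpTerm_periods_mem`).

For m = n a second power is needed. The sum of two reflected terms is unchanged modulo (1 - q^n)^2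
when the parameters move by multiples of 1 - q^n (`wpTerm_add_reflect_sub_mem`), so each c q^r may
be replaced by c q^(r+n). Write n + r = d(j+1). Then q^(r+n) = Q^(j+1), and up to a common unit the
deformed terms are values p(Q^k) of a Laurent polynomial with exponents between -(3j+1) and 3j+1
(`wpTerm_eq_wpPoly`); d ≥ 3 gives 3j+1 < n. Moreover p(1/(Ay)) = -p(y) (`wpPoly_reflect`), so
reversing the sum over 0 ≤ k < n turns it into -∑ p(q^θ Q^(k-j)) with n ∣ θ. Shifting the window by
j exchanges only values divisible by (1 - q^n)^2. Removing q^θ costs multiples of (1 - q^(θs)) ∑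
Q^(ks), which is zero for s = 0 and has both factors divisible by 1 - q^n for 0 < |s| < n. Thus the
sum is congruent to its own negative modulo the square (`sum_wpPoly_mem`). -/

/-! ### Congruences modulo φ O in a subring O of a field -/

section Subring

variable {F : Type*} [Field F]

/-- The nonzero elements of a field that lie in a subring together with their inverses. -/
def unitsIn (O : Subring F) : Submonoid F where
  carrier := {x | x ∈ O ∧ x⁻¹ ∈ O ∧ x ≠ 0}
  one_mem' := by simp [O.one_mem]
  mul_mem' := by
    rintro x y ⟨hx, hx', hx0⟩ ⟨hy, hy', hy0⟩
    exact ⟨O.mul_mem hx hy, by rw [mul_inv]; exact O.mul_mem hx' hy', mul_ne_zero hx0 hy0⟩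

/-- The set `φ O` of multiples of `φ` by elements of a subring `O`. -/
def multiplesIn (O : Subring F) (φ : F) : AddSubgroup F :=
  O.toAddSubgroup.map (AddMonoidHom.mulLeft φ)

variable {O : Subring F} {φ ψ : F}

theorem mem_of_mem_unitsIn {x : F} (h : x ∈ unitsIn O) : x ∈ O := h.1

theorem inv_mem_unitsIn {x : F} (h : x ∈ unitsIn O) : x⁻¹ ∈ unitsIn O :=
  ⟨h.2.1, by rw [inv_inv]; exact h.1, inv_ne_zero h.2.2⟩

theorem div_mem_unitsIn {x y : F} (hx : x ∈ unitsIn O) (hy : y ∈ unitsIn O) :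
    x / y ∈ unitsIn O := by
  rw [div_eq_mul_inv]; exact mul_mem hx (inv_mem_unitsIn hy)

theorem neg_mem_unitsIn {x : F} (hx : x ∈ unitsIn O) : -x ∈ unitsIn O :=
  ⟨neg_mem hx.1, by rw [inv_neg]; exact neg_mem hx.2.1, neg_ne_zero.mpr hx.2.2⟩

theorem zpow_mem_unitsIn {x : F} (hx : x ∈ unitsIn O) (e : ℤ) : x ^ e ∈ unitsIn O := by
  cases e with
  | ofNat k => simpa using pow_mem hx k
  | negSucc k => rw [zpow_negSucc]; exact inv_mem_unitsIn (pow_mem hx _)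

theorem div_mem_of_mem_unitsIn {x y : F} (hx : x ∈ O) (hy : y ∈ unitsIn O) : x / y ∈ O := by
  rw [div_eq_mul_inv]; exact mul_mem hx hy.2.1

theorem multiplesIn_mul_right {x y : F} (hx : x ∈ multiplesIn O φ) (hy : y ∈ O) :
    x * y ∈ multiplesIn O φ := by
  obtain ⟨h, hh, rfl⟩ := hx
  exact ⟨h * y, O.mul_mem hh hy, by simp [mul_assoc]⟩

theorem multiplesIn_mul_left {x y : F} (hx : x ∈ multiplesIn O φ) (hy : y ∈ O) :
    y * x ∈ multiplesIn O φ := by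
  rw [mul_comm]; exact multiplesIn_mul_right hx hy

theorem multiplesIn_mul {x y : F} (hx : x ∈ multiplesIn O φ) (hy : y ∈ multiplesIn O ψ) :
    x * y ∈ multiplesIn O (φ * ψ) := by
  obtain ⟨h, hh, rfl⟩ := hx
  obtain ⟨g, hg, rfl⟩ := hy
  exact ⟨h * g, O.mul_mem hh hg, by simp only [AddMonoidHom.coe_mulLeft]; ring⟩

theorem multiplesIn_div {x y : F} (hx : x ∈ multiplesIn O φ) (hy : y ∈ unitsIn O) :
    x / y ∈ multiplesIn O φ := by
  rw [div_eq_mul_inv]; exact multiplesIn_mul_right hx hy.2.1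

theorem mem_multiplesIn_of_mul_mem {x y : F} (hy : y ∈ unitsIn O)
    (h : y * x ∈ multiplesIn O φ) : x ∈ multiplesIn O φ := by
  have := multiplesIn_div h hy
  rwa [mul_div_cancel_left₀ _ hy.2.2] at this

theorem self_mem_multiplesIn : φ ∈ multiplesIn O φ := ⟨1, O.one_mem, by simp⟩

theorem mul_sub_mul_mem_multiplesIn {x x' y y' : F} (hx : x - x' ∈ multiplesIn O φ)
    (hy : y - y' ∈ multiplesIn O φ) (hx' : x' ∈ O) (hy1 : y ∈ O) :
    x * y - x' * y' ∈ multiplesIn O φ := by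
  have : x * y - x' * y' = (x - x') * y + x' * (y - y') := by ring
  rw [this]
  exact add_mem (multiplesIn_mul_right hx hy1) (multiplesIn_mul_left hy hx')

theorem prod_sub_prod_mem_multiplesIn {ι : Type*} (s : Finset ι) {x y : ι → F}
    (hx : ∀ i ∈ s, x i ∈ O) (hy : ∀ i ∈ s, y i ∈ O)
    (h : ∀ i ∈ s, x i - y i ∈ multiplesIn O φ) :
    ∏ i ∈ s, x i - ∏ i ∈ s, y i ∈ multiplesIn O φ := by
  classical
  induction s using Finset.induction_on with
  | empty => simp
  | insert i s hi ih =>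
    rw [Finset.prod_insert hi, Finset.prod_insert hi]
    simp only [Finset.mem_insert, forall_eq_or_imp] at hx hy h
    exact mul_sub_mul_mem_multiplesIn h.1 (ih hx.2 hy.2 h.2) hy.1 (prod_mem hx.2)

theorem pow_sub_pow_mem_multiplesIn {x y : F} (hx : x ∈ O) (hy : y ∈ O)
    (h : x - y ∈ multiplesIn O φ) (k : ℕ) : x ^ k - y ^ k ∈ multiplesIn O φ := by
  simpa using prod_sub_prod_mem_multiplesIn (Finset.range k) (x := fun _ => x) (y := fun _ => y)
    (fun _ _ => hx) (fun _ _ => hy) (fun _ _ => h)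

theorem inv_sub_inv_mem_multiplesIn {x y : F} (hx : x ∈ unitsIn O) (hy : y ∈ unitsIn O)
    (h : x - y ∈ multiplesIn O φ) : x⁻¹ - y⁻¹ ∈ multiplesIn O φ := by
  rw [inv_sub_inv hx.2.2 hy.2.2]
  refine multiplesIn_div ?_ (mul_mem hx hy)
  rw [← neg_sub]; exact neg_mem h

theorem div_sub_div_mem_multiplesIn {x x' y y' : F} (hx : x - x' ∈ multiplesIn O φ)
    (hy : y - y' ∈ multiplesIn O φ) (hx' : x' ∈ O) (hyu : y ∈ unitsIn O) (hyu' : y' ∈ unitsIn O) :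
    x / y - x' / y' ∈ multiplesIn O φ := by
  rw [div_eq_mul_inv, div_eq_mul_inv]
  exact mul_sub_mul_mem_multiplesIn hx (inv_sub_inv_mem_multiplesIn hyu hyu' hy) hx' hyu.2.1

theorem prod_mem_multiplesIn {ι : Type*} {s : Finset ι} {x : ι → F} {i : ι} (hi : i ∈ s)
    (hx : ∀ j ∈ s, x j ∈ O) (h : x i ∈ multiplesIn O φ) : ∏ j ∈ s, x j ∈ multiplesIn O φ := by
  classical
  rw [← Finset.mul_prod_erase s x hi]
  exact multiplesIn_mul_right h (prod_mem fun j hj => hx j (Finset.mem_of_mem_erase hj))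

end Subring

/-! ### Very-well-poised terms under the reflection k ↦ M - k -/

section WellPoised

variable {F : Type*} [Field F]

/-- The quotient `(b; Q)_k / (A Q / b; Q)_k` divided by `b ^ k`. -/
def wpQuot (A Q b : F) (k : ℕ) : F :=
  ∏ j ∈ Finset.range k, (1 - b * Q ^ j) / (b - A * Q ^ (j + 1))

/-- The factor relating the values of `wpQuot` at `k` and at `M - k`. -/
def reflFactor (A Q b : F) (M j : ℕ) : F := (1 - b * Q ^ j) / (b - A * Q ^ (M - j))

/-- The part of a very-well-poised term that does not depend on the numerator parameters. -/
def wpCoef (A Q : F) (k : ℕ) : F := (1 - A * Q ^ (2 * k)) * (A ^ 3 * Q ^ 2) ^ k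

/-- The term of a very-well-poised series with numerator parameters `b i`. -/
def wpTerm {ι : Type*} [Fintype ι] (A Q : F) (b : ι → F) (k : ℕ) : F :=
  wpCoef A Q k * ∏ i, wpQuot A Q (b i) k

/-- Raising k by one removes the last factor on the left and adds one on the right. Exchanging the
denominators of these two factors turns them into the reflection factors at k and M - 1 - k. The
multiplied-out form needs no nonvanishing hypotheses. -/
theorem wpQuot_reflect (A Q b : F) (M k : ℕ) (hk : k ≤ M) :
    wpQuot A Q b (M - k) *
        ∏ j ∈ Finset.range k, (reflFactor A Q b M j * reflFactor A Q b M (M - 1 - j))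
      = wpQuot A Q b k * ∏ j ∈ Finset.range M, reflFactor A Q b M j := by
  induction k with
  | zero =>
    simp only [wpQuot, reflFactor, Finset.prod_div_distrib, Nat.sub_zero, Finset.range_zero,
      Finset.prod_empty, mul_one, div_one, one_mul]
    congr 1
    rw [← Finset.prod_range_reflect (fun j => b - A * Q ^ (j + 1)) M]
    refine Finset.prod_congr rfl fun j hj => ?_
    rw [Finset.mem_range] at hj
    rw [show M - 1 - j + 1 = M - j by omega]
  | succ k ih =>
    have ih := ih (by omega)
    obtain ⟨l, rfl⟩ : ∃ l, M = l + k + 1 := ⟨M - k - 1, by omega⟩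
    have e1 : wpQuot A Q b (l + k + 1 - k)
        = wpQuot A Q b l * ((1 - b * Q ^ l) / (b - A * Q ^ (l + 1))) := by
      rw [show l + k + 1 - k = l + 1 by omega, wpQuot, Finset.prod_range_succ, wpQuot]
    have e2 : wpQuot A Q b (k + 1)
        = wpQuot A Q b k * ((1 - b * Q ^ k) / (b - A * Q ^ (k + 1))) := by
      rw [wpQuot, Finset.prod_range_succ, wpQuot]
    rw [e1] at ih
    rw [e2, Finset.prod_range_succ, show l + k + 1 - (k + 1) = l by omega,
      mul_right_comm (wpQuot A Q b k), ← ih]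
    simp only [reflFactor]
    rw [show l + k + 1 - k = l + 1 by omega, show l + k + 1 - 1 - k = l by omega,
      show l + k + 1 - l = k + 1 by omega]
    simp only [div_eq_mul_inv]
    ring

variable {O : Subring F} {φ A Q : F} {M : ℕ}

/-- The parameter `b` is admissible for a series of length `M`: all the factors of
`wpQuot A Q b M` are units. -/
structure Admissible (O : Subring F) (A Q : F) (M : ℕ) (b : F) : Prop where
  mem : b ∈ O
  num : ∀ j < M, 1 - b * Q ^ j ∈ unitsIn O
  den : ∀ j < M, b - A * Q ^ (j + 1) ∈ unitsIn O

theorem Admissible.reflFactor_mem {b : F} (hb : Admissible O A Q M b) {j : ℕ} (hj : j < M) :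
    reflFactor A Q b M j ∈ unitsIn O := by
  have := hb.den (M - 1 - j) (by omega)
  rw [show M - 1 - j + 1 = M - j by omega] at this
  exact div_mem_unitsIn (hb.num j hj) this

theorem Admissible.wpQuot_mem {b : F} (hb : Admissible O A Q M b) {k : ℕ} (hk : k ≤ M) :
    wpQuot A Q b k ∈ O := by
  refine prod_mem fun j hj => ?_
  rw [Finset.mem_range] at hj
  exact mem_of_mem_unitsIn (div_mem_unitsIn (hb.num j (by omega)) (hb.den j (by omega)))

/-- If A Q^M were exactly 1, then 1 - b Q^j = -Q^j (b - A Q^(M-j)): the factor would not depend on b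
at all. -/
theorem Admissible.reflFactor_congr (hA : A * Q ^ M - 1 ∈ multiplesIn O φ)
    {b : F} (hb : Admissible O A Q M b) {j : ℕ} (hj : j < M) :
    reflFactor A Q b M j - -Q ^ j ∈ multiplesIn O φ := by
  have h := hb.den (M - 1 - j) (by omega)
  rw [show M - 1 - j + 1 = M - j by omega] at h
  have e : reflFactor A Q b M j - -Q ^ j
      = -(A * Q ^ M - 1) / (b - A * Q ^ (M - j)) := by
    rw [reflFactor, sub_neg_eq_add, div_add' _ _ _ h.2.2]
    congr 1
    have : Q ^ M = Q ^ (M - j) * Q ^ j := by rw [← pow_add]; congr 1; omega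
    rw [this]; ring
  rw [e]
  exact multiplesIn_div (neg_mem hA) h

/-- The source of the second power of φ: the numerator of the difference is (A Q^M - 1)(b - b'). -/
theorem Admissible.reflFactor_sub (hA : A * Q ^ M - 1 ∈ multiplesIn O φ)
    {b b' : F} (hb : Admissible O A Q M b) (hb' : Admissible O A Q M b')
    (hbb : b - b' ∈ multiplesIn O φ) {j : ℕ} (hj : j < M) :
    reflFactor A Q b M j - reflFactor A Q b' M j ∈ multiplesIn O (φ * φ) := by
  have h := hb.den (M - 1 - j) (by omega)
  have h' := hb'.den (M - 1 - j) (by omega)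
  rw [show M - 1 - j + 1 = M - j by omega] at h h'
  have e : reflFactor A Q b M j - reflFactor A Q b' M j
      = (A * Q ^ M - 1) * (b - b') / ((b - A * Q ^ (M - j)) * (b' - A * Q ^ (M - j))) := by
    rw [reflFactor, reflFactor, div_sub_div _ _ h.2.2 h'.2.2]
    congr 1
    have : Q ^ M = Q ^ (M - j) * Q ^ j := by rw [← pow_add]; congr 1; omega
    rw [this]; ring
  rw [e]
  exact multiplesIn_div (multiplesIn_mul hA hbb) (mul_mem h h')

theorem Admissible.wpQuot_sub {b b' : F} (hQ : Q ∈ O) (hb : Admissible O A Q M b)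
    (hb' : Admissible O A Q M b') (hbb : b - b' ∈ multiplesIn O φ) {k : ℕ} (hk : k ≤ M) :
    wpQuot A Q b k - wpQuot A Q b' k ∈ multiplesIn O φ := by
  refine prod_sub_prod_mem_multiplesIn _ ?_ ?_ ?_ <;> intro j hj <;> rw [Finset.mem_range] at hj
  · exact mem_of_mem_unitsIn (div_mem_unitsIn (hb.num j (by omega)) (hb.den j (by omega)))
  · exact mem_of_mem_unitsIn (div_mem_unitsIn (hb'.num j (by omega)) (hb'.den j (by omega)))
  · refine div_sub_div_mem_multiplesIn ?_ ?_ (hb'.num j (by omega)).1 (hb.den j (by omega))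
      (hb'.den j (by omega))
    · rw [show 1 - b * Q ^ j - (1 - b' * Q ^ j) = -((b - b') * Q ^ j) by ring]
      exact neg_mem (multiplesIn_mul_right hbb (pow_mem hQ j))
    · rwa [sub_sub_sub_cancel_right]

theorem wpCoef_mem (hQ : Q ∈ O) (hA : A ∈ O) (k : ℕ) : wpCoef A Q k ∈ O :=
  mul_mem (sub_mem O.one_mem (mul_mem hA (pow_mem hQ _)))
    (pow_mem (mul_mem (pow_mem hA _) (pow_mem hQ _)) _)

theorem wpCoef_sub {A' : F} (hQ : Q ∈ O) (hA : A ∈ O) (hA' : A' ∈ O)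
    (h : A - A' ∈ multiplesIn O φ) (k : ℕ) :
    wpCoef A Q k - wpCoef A' Q k ∈ multiplesIn O φ := by
  have hm : ∀ {x}, x ∈ O → x ^ 3 * Q ^ 2 ∈ O := fun hx => mul_mem (pow_mem hx _) (pow_mem hQ _)
  refine mul_sub_mul_mem_multiplesIn ?_ ?_ (sub_mem O.one_mem (mul_mem hA' (pow_mem hQ _)))
    (pow_mem (hm hA) _)
  · rw [show 1 - A * Q ^ (2 * k) - (1 - A' * Q ^ (2 * k)) = -((A - A') * Q ^ (2 * k)) by ring]
    exact neg_mem (multiplesIn_mul_right h (pow_mem hQ _))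
  · refine pow_sub_pow_mem_multiplesIn (hm hA) (hm hA') ?_ k
    rw [← sub_mul]
    exact multiplesIn_mul_right (pow_sub_pow_mem_multiplesIn hA hA' h 3) (pow_mem hQ _)

/-- The limiting case A = Q^(-M), M = k + l, of the reflection, with all six reflection factors
replaced by -Q^j. The even exponent removes the signs, and 1 - Q^(k-l) = -Q^(k-l) (1 - Q^(l-k))
supplies the minus sign; the remaining powers of Q agree. -/
theorem wpCoef_reflect (hQ : Q ≠ 0) (k l : ℕ) :
    wpCoef (Q ^ (k + l))⁻¹ Q k * ((Q ^ (k + l - 1)) ^ k) ^ 6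
      + wpCoef (Q ^ (k + l))⁻¹ Q l * (∏ j ∈ Finset.range (k + l), -Q ^ j) ^ 6 = 0 := by
  have e : (∏ j ∈ Finset.range (k + l), -Q ^ j) ^ 6 = Q ^ (3 * ((k + l) * (k + l - 1))) := by
    rw [Finset.prod_neg, mul_pow, ← pow_mul, Finset.prod_pow_eq_pow_sum, ← pow_mul,
      mul_comm _ 6, pow_mul (-1 : F)]
    norm_num
    congr 1
    have := Finset.sum_range_id_mul_two (k + l)
    omega
  rw [e]
  rcases Nat.eq_zero_or_pos (k + l) with h | h
  · obtain ⟨rfl, rfl⟩ : k = 0 ∧ l = 0 := by omega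
    simp [wpCoef]
  obtain ⟨m, hm⟩ : ∃ m, k + l = m + 1 := ⟨k + l - 1, by omega⟩
  have hk : (k : ℤ) = m + 1 - l := by omega
  rw [hm, Nat.add_sub_cancel]
  have key : ∀ i : ℕ, wpCoef (Q ^ (m + 1))⁻¹ Q i
      = (1 - Q ^ (2 * i - (m + 1) : ℤ)) * Q ^ ((2 - 3 * (m + 1)) * i : ℤ) := by
    intro i
    rw [wpCoef]
    congr 1
    · rw [zpow_sub₀ hQ, div_eq_inv_mul]
      norm_cast
    · rw [zpow_mul, zpow_natCast, zpow_sub₀ hQ, div_eq_inv_mul, inv_pow, ← pow_mul, mul_comm 3]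
      norm_cast
  rw [key, key, ← pow_mul, ← pow_mul, ← zpow_natCast, ← zpow_natCast]
  push_cast
  rw [hk, mul_assoc, mul_assoc, ← zpow_add₀ hQ, ← zpow_add₀ hQ, one_sub_mul, one_sub_mul,
    ← zpow_add₀ hQ, ← zpow_add₀ hQ]
  ring_nf

variable {ι : Type*} [Fintype ι]

/-- Separates the pair sum, times a product that is a unit for admissible parameters, into V · E.
Only V involves `wpQuot`; E depends on b through reflection factors alone. -/
theorem wpTerm_add_reflect (A Q : F) (b : ι → F) {k : ℕ} (hk : k ≤ M) :
    (∏ i, ∏ j ∈ Finset.range k, (reflFactor A Q (b i) M j * reflFactor A Q (b i) M (M - 1 - j)))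
        * (wpTerm A Q b k + wpTerm A Q b (M - k))
      = (∏ i, wpQuot A Q (b i) k) *
        (wpCoef A Q k * (∏ i, ∏ j ∈ Finset.range k,
            (reflFactor A Q (b i) M j * reflFactor A Q (b i) M (M - 1 - j)))
          + wpCoef A Q (M - k) * ∏ i, ∏ j ∈ Finset.range M, reflFactor A Q (b i) M j) := by
  have h : (∏ i, wpQuot A Q (b i) (M - k)) * (∏ i, ∏ j ∈ Finset.range k,
        (reflFactor A Q (b i) M j * reflFactor A Q (b i) M (M - 1 - j)))
      = (∏ i, wpQuot A Q (b i) k) * ∏ i, ∏ j ∈ Finset.range M, reflFactor A Q (b i) M j := by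
    rw [← Finset.prod_mul_distrib, ← Finset.prod_mul_distrib]
    exact Finset.prod_congr rfl fun i _ => wpQuot_reflect A Q (b i) M k hk
  rw [wpTerm, wpTerm]
  linear_combination (wpCoef A Q (M - k)) * h

theorem prod_reflFactor_mem {b : ι → F} (hb : ∀ i, Admissible O A Q M (b i)) {k : ℕ}
    (hk : k ≤ M) :
    ∏ i, ∏ j ∈ Finset.range k, (reflFactor A Q (b i) M j * reflFactor A Q (b i) M (M - 1 - j))
      ∈ unitsIn O := by
  refine prod_mem fun i _ => prod_mem fun j hj => ?_
  rw [Finset.mem_range] at hj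
  exact mul_mem ((hb i).reflFactor_mem (by omega)) ((hb i).reflFactor_mem (by omega))

/-- Modulo φ one may put A = Q^(-M) and every reflection factor equal to -Q^j, which leaves
`wpCoef_reflect`. -/
theorem wpCoef_add_reflect_mem (hι : Fintype.card ι = 6) (hQ : Q ∈ unitsIn O) (hA : A ∈ O)
    (hη : A * Q ^ M - 1 ∈ multiplesIn O φ) {b : ι → F} (hb : ∀ i, Admissible O A Q M (b i))
    {k : ℕ} (hk : k ≤ M) :
    wpCoef A Q k * (∏ i, ∏ j ∈ Finset.range k,
            (reflFactor A Q (b i) M j * reflFactor A Q (b i) M (M - 1 - j)))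
          + wpCoef A Q (M - k) * ∏ i, ∏ j ∈ Finset.range M, reflFactor A Q (b i) M j
      ∈ multiplesIn O φ := by
  have hA0 : (Q ^ M)⁻¹ ∈ O := (inv_mem_unitsIn (pow_mem hQ M)).1
  have hAA : A - (Q ^ M)⁻¹ ∈ multiplesIn O φ := by
    have : A - (Q ^ M)⁻¹ = (A * Q ^ M - 1) * (Q ^ M)⁻¹ := by
      rw [sub_mul, mul_assoc, mul_inv_cancel₀ (pow_mem hQ M).2.2, mul_one, one_mul]
    rw [this]
    exact multiplesIn_mul_right hη hA0
  have hQj : ∀ j, -Q ^ j ∈ O := fun j => neg_mem (pow_mem hQ.1 j)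
  have h1 : (∏ i, ∏ j ∈ Finset.range k,
        (reflFactor A Q (b i) M j * reflFactor A Q (b i) M (M - 1 - j)))
      - ∏ _i : ι, ∏ _j ∈ Finset.range k, Q ^ (M - 1) ∈ multiplesIn O φ := by
    refine prod_sub_prod_mem_multiplesIn _ (fun i _ => prod_mem fun j hj => ?_)
      (fun i _ => prod_mem fun j hj => pow_mem hQ.1 _)
      (fun i _ => prod_sub_prod_mem_multiplesIn _ (fun j hj => ?_)
        (fun j hj => pow_mem hQ.1 _) fun j hj => ?_) <;> rw [Finset.mem_range] at hj
    · exact (mul_mem ((hb i).reflFactor_mem (by omega)) ((hb i).reflFactor_mem (by omega))).1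
    · exact (mul_mem ((hb i).reflFactor_mem (by omega)) ((hb i).reflFactor_mem (by omega))).1
    · have : Q ^ (M - 1) = -Q ^ j * -Q ^ (M - 1 - j) := by
        rw [neg_mul_neg, ← pow_add]; congr 1; omega
      rw [this]
      exact mul_sub_mul_mem_multiplesIn ((hb i).reflFactor_congr hη (by omega))
        ((hb i).reflFactor_congr hη (by omega)) (hQj j) ((hb i).reflFactor_mem (by omega)).1
  have h2 : (∏ i, ∏ j ∈ Finset.range M, reflFactor A Q (b i) M j)
      - ∏ _i : ι, ∏ j ∈ Finset.range M, -Q ^ j ∈ multiplesIn O φ := by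
    refine prod_sub_prod_mem_multiplesIn _ (fun i _ => prod_mem fun j hj => ?_)
      (fun i _ => prod_mem fun j hj => hQj j)
      (fun i _ => prod_sub_prod_mem_multiplesIn _ (fun j hj => ?_)
        (fun j hj => hQj j) fun j hj => ?_) <;> rw [Finset.mem_range] at hj
    · exact ((hb i).reflFactor_mem hj).1
    · exact ((hb i).reflFactor_mem hj).1
    · exact (hb i).reflFactor_congr hη hj
  have h3 := mul_sub_mul_mem_multiplesIn (wpCoef_sub hQ.1 hA hA0 hAA k) h1
    (wpCoef_mem hQ.1 hA0 k) (prod_reflFactor_mem hb hk).1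
  have h4 := mul_sub_mul_mem_multiplesIn (wpCoef_sub hQ.1 hA hA0 hAA (M - k)) h2
    (wpCoef_mem hQ.1 hA0 (M - k)) (prod_mem fun i _ => prod_mem fun j hj =>
      ((hb i).reflFactor_mem (Finset.mem_range.mp hj)).1)
  have h5 := add_mem h3 h4
  have h6 := wpCoef_reflect hQ.2.2 k (M - k)
  rw [show k + (M - k) = M by omega] at h6
  simp only [Finset.prod_const, Finset.card_univ, hι, Finset.card_range] at h5
  rwa [sub_add_sub_comm, h6, sub_zero] at h5

theorem wpTerm_mem (hQ : Q ∈ O) (hA : A ∈ O) {b : ι → F}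
    (hb : ∀ i, Admissible O A Q M (b i)) {k : ℕ} (hk : k ≤ M) : wpTerm A Q b k ∈ O :=
  mul_mem (wpCoef_mem hQ hA k) (prod_mem fun i _ => (hb i).wpQuot_mem hk)

theorem wpTerm_add_reflect_mem (hι : Fintype.card ι = 6) (hQ : Q ∈ unitsIn O) (hA : A ∈ O)
    (hη : A * Q ^ M - 1 ∈ multiplesIn O φ) {b : ι → F} (hb : ∀ i, Admissible O A Q M (b i))
    {k : ℕ} (hk : k ≤ M) :
    wpTerm A Q b k + wpTerm A Q b (M - k) ∈ multiplesIn O φ := by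
  refine mem_multiplesIn_of_mul_mem (prod_reflFactor_mem hb hk) ?_
  rw [wpTerm_add_reflect A Q b hk]
  exact multiplesIn_mul_left (wpCoef_add_reflect_mem hι hQ hA hη hb hk)
    (prod_mem fun i _ => (hb i).wpQuot_mem hk)

/-- In the factorization V · E, the change of V is a multiple of φ and meets E, itself a multiple of
φ. Everything else depends on the parameters only through reflection factors, which already agree
modulo φ². -/
theorem wpTerm_add_reflect_sub_mem (hι : Fintype.card ι = 6) (hQ : Q ∈ unitsIn O) (hA : A ∈ O)
    (hη : A * Q ^ M - 1 ∈ multiplesIn O φ) {b b' : ι → F}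
    (hb : ∀ i, Admissible O A Q M (b i)) (hb' : ∀ i, Admissible O A Q M (b' i))
    (hbb : ∀ i, b i - b' i ∈ multiplesIn O φ) {k : ℕ} (hk : k ≤ M) :
    (wpTerm A Q b k + wpTerm A Q b (M - k)) - (wpTerm A Q b' k + wpTerm A Q b' (M - k))
      ∈ multiplesIn O (φ * φ) := by
  have hB := prod_reflFactor_mem hb hk
  have hB' := prod_reflFactor_mem hb' hk
  have e := wpTerm_add_reflect A Q b hk
  have e' := wpTerm_add_reflect A Q b' hk
  have hE := wpCoef_add_reflect_mem hι hQ hA hη hb hk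
  have hV' : ∏ i, wpQuot A Q (b' i) k ∈ O := prod_mem fun i _ => (hb' i).wpQuot_mem hk
  have hVV : (∏ i, wpQuot A Q (b i) k) - ∏ i, wpQuot A Q (b' i) k ∈ multiplesIn O φ :=
    prod_sub_prod_mem_multiplesIn _ (fun i _ => (hb i).wpQuot_mem hk)
      (fun i _ => (hb' i).wpQuot_mem hk)
      (fun i _ => (hb i).wpQuot_sub hQ.1 (hb' i) (hbb i) hk)
  have hBB : (∏ i, ∏ j ∈ Finset.range k,
        (reflFactor A Q (b i) M j * reflFactor A Q (b i) M (M - 1 - j)))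
      - ∏ i, ∏ j ∈ Finset.range k,
        (reflFactor A Q (b' i) M j * reflFactor A Q (b' i) M (M - 1 - j))
      ∈ multiplesIn O (φ * φ) := by
    refine prod_sub_prod_mem_multiplesIn _ (fun i _ => prod_mem fun j hj => ?_)
      (fun i _ => prod_mem fun j hj => ?_)
      (fun i _ => prod_sub_prod_mem_multiplesIn _ (fun j hj => ?_)
        (fun j hj => ?_) fun j hj => ?_) <;> rw [Finset.mem_range] at hj
    · exact (mul_mem ((hb i).reflFactor_mem (by omega)) ((hb i).reflFactor_mem (by omega))).1
    · exact (mul_mem ((hb' i).reflFactor_mem (by omega)) ((hb' i).reflFactor_mem (by omega))).1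
    · exact (mul_mem ((hb i).reflFactor_mem (by omega)) ((hb i).reflFactor_mem (by omega))).1
    · exact (mul_mem ((hb' i).reflFactor_mem (by omega)) ((hb' i).reflFactor_mem (by omega))).1
    · exact mul_sub_mul_mem_multiplesIn ((hb i).reflFactor_sub hη (hb' i) (hbb i) (by omega))
        ((hb i).reflFactor_sub hη (hb' i) (hbb i) (by omega))
        ((hb' i).reflFactor_mem (by omega)).1 ((hb i).reflFactor_mem (by omega)).1
  have hPP : (∏ i, ∏ j ∈ Finset.range M, reflFactor A Q (b i) M j)
      - ∏ i, ∏ j ∈ Finset.range M, reflFactor A Q (b' i) M j ∈ multiplesIn O (φ * φ) := by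
    refine prod_sub_prod_mem_multiplesIn _ (fun i _ => prod_mem fun j hj => ?_)
      (fun i _ => prod_mem fun j hj => ?_)
      (fun i _ => prod_sub_prod_mem_multiplesIn _ (fun j hj => ?_)
        (fun j hj => ?_) fun j hj => ?_) <;> rw [Finset.mem_range] at hj
    · exact ((hb i).reflFactor_mem hj).1
    · exact ((hb' i).reflFactor_mem hj).1
    · exact ((hb i).reflFactor_mem hj).1
    · exact ((hb' i).reflFactor_mem hj).1
    · exact (hb i).reflFactor_sub hη (hb' i) (hbb i) hj
  set B := ∏ i, ∏ j ∈ Finset.range k,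
        (reflFactor A Q (b i) M j * reflFactor A Q (b i) M (M - 1 - j))
  set B' := ∏ i, ∏ j ∈ Finset.range k,
        (reflFactor A Q (b' i) M j * reflFactor A Q (b' i) M (M - 1 - j))
  set P := ∏ i, ∏ j ∈ Finset.range M, reflFactor A Q (b i) M j
  set P' := ∏ i, ∏ j ∈ Finset.range M, reflFactor A Q (b' i) M j
  set V := ∏ i, wpQuot A Q (b i) k
  set V' := ∏ i, wpQuot A Q (b' i) k
  set T := wpTerm A Q b k + wpTerm A Q b (M - k)
  have hT' : wpTerm A Q b' k + wpTerm A Q b' (M - k) ∈ O :=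
    add_mem (wpTerm_mem hQ.1 hA hb' hk) (wpTerm_mem hQ.1 hA hb' (Nat.sub_le _ _))
  set T' := wpTerm A Q b' k + wpTerm A Q b' (M - k)
  refine mem_multiplesIn_of_mul_mem hB ?_
  have e3 : B * (T - T') = (V - V') * (wpCoef A Q k * B + wpCoef A Q (M - k) * P)
      + V' * (wpCoef A Q k * (B - B') + wpCoef A Q (M - k) * (P - P')) - (B - B') * T' := by
    linear_combination e - e'
  rw [e3]
  refine sub_mem (add_mem (multiplesIn_mul hVV hE) (multiplesIn_mul_left (add_mem ?_ ?_) hV')) ?_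
  · exact multiplesIn_mul_left hBB (wpCoef_mem hQ.1 hA _)
  · exact multiplesIn_mul_left hPP (wpCoef_mem hQ.1 hA _)
  · exact multiplesIn_mul_right hBB hT'

/-- A sum over `0, …, M` is determined by the sums of its terms at `k` and `M - k`. -/
theorem sum_mem_of_add_reflect {S : AddSubgroup F} (x : ℕ → F)
    (hS : ∀ y, 2 * y ∈ S → y ∈ S) (h : ∀ k ≤ M, x k + x (M - k) ∈ S) :
    ∑ k ∈ Finset.range (M + 1), x k ∈ S := by
  apply hS
  have e := Finset.sum_range_reflect x (M + 1)
  rw [two_mul]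
  nth_rewrite 1 [← e]
  rw [← Finset.sum_add_distrib]
  refine sum_mem fun k hk => ?_
  rw [Finset.mem_range] at hk
  rw [add_comm, show M + 1 - 1 - k = M - k by omega]
  exact h k (by omega)

end WellPoised

/-! ### Reduction at a primitive m-th root of unity -/

section Cyclotomic

variable {F : Type*} [Field F]

/-- The properties of `q` in a subring `O` in which `q` reduces to a primitive `m`-th root of unity
modulo `1 - q ^ m`. -/
structure IsCycloSubring (O : Subring F) (m : ℕ) (q : F) : Prop where
  q_mem : q ∈ unitsIn O
  one_sub : ∀ e : ℤ, ¬ (m : ℤ) ∣ e → 1 - q ^ e ∈ unitsIn O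
  geom : ∀ t : ℕ, 0 < t → ∑ i ∈ Finset.range t, (q ^ m) ^ i ∈ unitsIn O
  ne_one : q ^ m ≠ 1
  two_mem : (2 : F) ∈ unitsIn O

/-- Parameters that are either `1` or generic with respect to the powers of `q`. -/
structure IsParam (O : Subring F) (q c : F) : Prop where
  mem : c ∈ unitsIn O
  generic : c = 1 ∨ ∀ e : ℤ, 1 - c * q ^ e ∈ unitsIn O

variable {O : Subring F} {m : ℕ} {q : F}

theorem IsParam.one : IsParam O q 1 := ⟨one_mem _, Or.inl rfl⟩

theorem IsParam.inv {c : F} (hq : q ∈ unitsIn O) (hc : IsParam O q c) : IsParam O q c⁻¹ := by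
  refine ⟨inv_mem_unitsIn hc.mem, hc.generic.imp (fun h => by rw [h, inv_one]) fun h e => ?_⟩
  have e1 : 1 - c⁻¹ * q ^ e = -(c⁻¹ * q ^ e) * (1 - c * q ^ (-e)) := by
    have h1 := hc.mem.2.2
    have h2 := (zpow_mem_unitsIn hq e).2.2
    rw [zpow_neg]
    field_simp
    ring
  rw [e1]
  exact mul_mem (neg_mem_unitsIn (mul_mem (inv_mem_unitsIn hc.mem) (zpow_mem_unitsIn hq e))) (h _)

theorem one_sub_zpow_mem {x : F} (hx : x ∈ unitsIn O) (e : ℤ) :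
    1 - x ^ e ∈ multiplesIn O (1 - x) := by
  have hn : ∀ k : ℕ, 1 - x ^ k ∈ multiplesIn O (1 - x) := fun k => by
    simpa using pow_sub_pow_mem_multiplesIn O.one_mem hx.1
      (self_mem_multiplesIn (O := O) (φ := 1 - x)) k
  cases e with
  | ofNat k => simpa using hn k
  | negSucc k =>
    rw [zpow_negSucc]
    have hu := pow_mem hx (k + 1)
    rw [show 1 - (x ^ (k + 1))⁻¹ = -((1 - x ^ (k + 1)) * (x ^ (k + 1))⁻¹) by
      rw [sub_mul, mul_inv_cancel₀ hu.2.2]; ring]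
    exact neg_mem (multiplesIn_mul_right (hn _) hu.2.1)

variable {c : F} {d M : ℕ} {r u : ℤ}

namespace IsCycloSubring

theorem one_sub_zpow_mem_of_dvd (h : IsCycloSubring O m q) {e : ℤ} (he : (m : ℤ) ∣ e) :
    1 - q ^ e ∈ multiplesIn O (1 - q ^ m) := by
  obtain ⟨t, rfl⟩ := he
  rw [zpow_mul, zpow_natCast]
  exact one_sub_zpow_mem (pow_mem h.q_mem m) t

theorem zpow_sub_zpow_mem (h : IsCycloSubring O m q) {e e' : ℤ} (he : (m : ℤ) ∣ e - e') :
    q ^ e - q ^ e' ∈ multiplesIn O (1 - q ^ m) := by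
  have hq := h.q_mem.2.2
  rw [show q ^ e - q ^ e' = -((1 - q ^ (e - e')) * q ^ e') by
    rw [zpow_sub₀ hq]; field_simp [zpow_ne_zero e' hq]; ring]
  exact neg_mem (multiplesIn_mul_right (h.one_sub_zpow_mem_of_dvd he) (zpow_mem_unitsIn h.q_mem _).1)

theorem one_sub_param (h : IsCycloSubring O m q) (hc : IsParam O q c) {e : ℤ}
    (he : ¬ (m : ℤ) ∣ e) : 1 - c * q ^ e ∈ unitsIn O := by
  rcases hc.generic with rfl | hg
  · rw [one_mul]; exact h.one_sub e he
  · exact hg e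

theorem den_mem (h : IsCycloSubring O m q) (hmd : IsCoprime (m : ℤ) d) (hc : IsParam O q c)
    (hu : (m : ℤ) ∣ u - r) {j : ℕ} (hj : ¬ (m : ℤ) ∣ (j + 1 : ℕ)) :
    c * q ^ u - q ^ r * (q ^ d) ^ (j + 1) ∈ unitsIn O := by
  have hq := h.q_mem.2.2
  have e : c * q ^ u - q ^ r * (q ^ d) ^ (j + 1)
      = -(q ^ r * (q ^ d) ^ (j + 1)) * (1 - c * q ^ (u - r - d * (j + 1 : ℕ))) := by
    have e2 : q ^ (u - r - d * (j + 1 : ℕ)) * (q ^ r * (q ^ d) ^ (j + 1)) = q ^ u := by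
      rw [← pow_mul, ← zpow_natCast q (d * (j + 1)), ← zpow_add₀ hq, ← zpow_add₀ hq]
      congr 1; push_cast; ring
    linear_combination (-c) * e2
  rw [e]
  refine mul_mem (neg_mem_unitsIn (mul_mem (zpow_mem_unitsIn h.q_mem _)
    (pow_mem (pow_mem h.q_mem _) _))) (h.one_sub_param hc fun hd => hj ?_)
  have := (dvd_sub_right hu).mp hd
  exact hmd.dvd_of_dvd_mul_left this

/-- A numerator factor can fail to be a unit only at j ≡ M, a denominator factor only at j ≡ -1
modulo m; neither occurs for j < M < m. -/
theorem admissible (h : IsCycloSubring O m q) (hmd : IsCoprime (m : ℤ) d) (hc : IsParam O q c)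
    (hu : (m : ℤ) ∣ u - r) (hM : M < m) (hrM : (m : ℤ) ∣ r + d * M) :
    Admissible O (q ^ r) (q ^ d) M (c * q ^ u) where
  mem := mul_mem hc.mem.1 (zpow_mem_unitsIn h.q_mem _).1
  num j hj := by
    have e : c * q ^ u * (q ^ d) ^ j = c * q ^ (u + d * j) := by
      rw [← pow_mul, ← zpow_natCast, mul_assoc, ← zpow_add₀ h.q_mem.2.2]
      push_cast; rfl
    rw [e]
    refine h.one_sub_param hc fun hd => ?_
    have h1 : (m : ℤ) ∣ d * ((M : ℤ) - j) := by
      have := dvd_add (dvd_sub hrM hd) hu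
      rwa [show r + d * M - (u + d * j) + (u - r) = d * ((M : ℤ) - j) by ring] at this
    have h2 := Int.le_of_dvd (by omega) (hmd.dvd_of_dvd_mul_left h1)
    omega
  den j hj := h.den_mem hmd hc hu fun hd => by
    have := Int.le_of_dvd (by omega) hd
    omega

theorem num_mem (h : IsCycloSubring O m q) (hc : IsParam O q c) (u : ℤ) (j : ℕ) :
    1 - c * q ^ u * (q ^ d) ^ j ∈ O :=
  sub_mem O.one_mem (mul_mem (mul_mem hc.mem.1 (zpow_mem_unitsIn h.q_mem _).1)
    (pow_mem (pow_mem h.q_mem.1 _) _))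

theorem wpQuot_mem (h : IsCycloSubring O m q) (hmd : IsCoprime (m : ℤ) d) (hc : IsParam O q c)
    (hu : (m : ℤ) ∣ u - r) {k : ℕ} (hk : k < m) :
    wpQuot (q ^ r) (q ^ d) (c * q ^ u) k ∈ O := by
  refine prod_mem fun j hj => ?_
  rw [Finset.mem_range] at hj
  refine div_mem_of_mem_unitsIn (h.num_mem hc u j) (h.den_mem hmd hc hu fun hd => ?_)
  have := Int.le_of_dvd (by omega) hd
  omega

/-- Once k exceeds M the product contains the numerator factor 1 - q^(u + dM), whose exponent is a
multiple of m. -/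
theorem wpQuot_mem_multiplesIn (h : IsCycloSubring O m q) (hmd : IsCoprime (m : ℤ) d)
    (hu : (m : ℤ) ∣ u - r) (hrM : (m : ℤ) ∣ r + d * M) {k : ℕ} (hMk : M < k) (hk : k < m) :
    wpQuot (q ^ r) (q ^ d) (q ^ u) k ∈ multiplesIn O (1 - q ^ m) := by
  have hden : ∀ j < k, q ^ u - q ^ r * (q ^ d) ^ (j + 1) ∈ unitsIn O := fun j hj => by
    have := h.den_mem hmd IsParam.one hu (j := j) fun hd => by
      have := Int.le_of_dvd (by omega) hd
      omega
    rwa [one_mul] at this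
  refine prod_mem_multiplesIn (i := M) (Finset.mem_range.mpr hMk) (fun j hj => ?_) ?_
  · refine div_mem_of_mem_unitsIn ?_ (hden j (Finset.mem_range.mp hj))
    have := h.num_mem (d := d) IsParam.one u j
    rwa [one_mul] at this
  · refine multiplesIn_div ?_ (hden M hMk)
    rw [← pow_mul, ← zpow_natCast q (d * M), ← zpow_add₀ h.q_mem.2.2]
    refine h.one_sub_zpow_mem_of_dvd ?_
    have := dvd_add hrM hu
    rw [show r + d * M + (u - r) = u + d * M by ring] at this
    push_cast
    exact this

end IsCycloSubring

/-- The six numerator parameters `c i * q ^ u` and `q ^ r / c i`. -/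
def wpParams (q : F) (c : Fin 3 → F) (r u : ℤ) : Fin 3 ⊕ Fin 3 → F :=
  Sum.elim (fun i => c i * q ^ u) (fun i => (c i)⁻¹ * q ^ r)

namespace IsCycloSubring

variable {c : Fin 3 → F}

theorem admissible_wpParams (h : IsCycloSubring O m q) (hmd : IsCoprime (m : ℤ) d)
    (hc : ∀ i, IsParam O q (c i)) (hu : (m : ℤ) ∣ u - r) (hM : M < m)
    (hrM : (m : ℤ) ∣ r + d * M) (i : Fin 3 ⊕ Fin 3) :
    Admissible O (q ^ r) (q ^ d) M (wpParams q c r u i) := by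
  rcases i with i | i
  · exact h.admissible hmd (hc i) hu hM hrM
  · exact h.admissible hmd ((hc i).inv h.q_mem) (by simp) hM hrM

theorem wpQuot_wpParams_mem (h : IsCycloSubring O m q) (hmd : IsCoprime (m : ℤ) d)
    (hc : ∀ i, IsParam O q (c i)) (hu : (m : ℤ) ∣ u - r) {k : ℕ} (hk : k < m)
    (i : Fin 3 ⊕ Fin 3) : wpQuot (q ^ r) (q ^ d) (wpParams q c r u i) k ∈ O := by
  rcases i with i | i
  · exact h.wpQuot_mem hmd (hc i) hu hk
  · exact h.wpQuot_mem hmd ((hc i).inv h.q_mem) (by simp) hk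

theorem eta_mem (h : IsCycloSubring O m q) (hrM : (m : ℤ) ∣ r + d * M) :
    q ^ r * (q ^ d) ^ M - 1 ∈ multiplesIn O (1 - q ^ m) := by
  rw [← pow_mul, ← zpow_natCast q (d * M), ← zpow_add₀ h.q_mem.2.2, ← neg_sub (1 : F)]
  push_cast
  exact neg_mem (h.one_sub_zpow_mem_of_dvd hrM)

theorem sum_wpTerm_mem (h : IsCycloSubring O m q) (hmd : IsCoprime (m : ℤ) d)
    (hc : ∀ i, IsParam O q (c i)) (hu : (m : ℤ) ∣ u - r) (hM : M < m)
    (hrM : (m : ℤ) ∣ r + d * M) :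
    ∑ k ∈ Finset.range (M + 1), wpTerm (q ^ r) (q ^ d) (wpParams q c r u) k
      ∈ multiplesIn O (1 - q ^ m) :=
  sum_mem_of_add_reflect _ (fun _ => mem_multiplesIn_of_mul_mem h.two_mem) fun _ hk =>
    wpTerm_add_reflect_mem rfl (pow_mem h.q_mem d) (zpow_mem_unitsIn h.q_mem r).1
      (h.eta_mem hrM) (h.admissible_wpParams hmd hc hu hM hrM) hk

/-- Permits the deformation of c q^r to c q^u modulo the square, the parameters q^r/c staying fixed.
-/
theorem sum_wpTerm_sub_mem (h : IsCycloSubring O m q) (hmd : IsCoprime (m : ℤ) d)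
    (hc : ∀ i, IsParam O q (c i)) (hu : (m : ℤ) ∣ u - r) (hM : M < m)
    (hrM : (m : ℤ) ∣ r + d * M) :
    ∑ k ∈ Finset.range (M + 1), wpTerm (q ^ r) (q ^ d) (wpParams q c r r) k
      - ∑ k ∈ Finset.range (M + 1), wpTerm (q ^ r) (q ^ d) (wpParams q c r u) k
      ∈ multiplesIn O ((1 - q ^ m) * (1 - q ^ m)) := by
  rw [← Finset.sum_sub_distrib]
  refine sum_mem_of_add_reflect _ (fun _ => mem_multiplesIn_of_mul_mem h.two_mem) fun k hk => ?_
  rw [sub_add_sub_comm]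
  refine wpTerm_add_reflect_sub_mem rfl (pow_mem h.q_mem d) (zpow_mem_unitsIn h.q_mem r).1
      (h.eta_mem hrM) (h.admissible_wpParams hmd hc (by simp) hM hrM)
      (h.admissible_wpParams hmd hc hu hM hrM) (fun i => ?_) hk
  rcases i with i | i
  · simp only [wpParams, Sum.elim_inl]
    rw [← mul_sub]
    exact multiplesIn_mul_left (h.zpow_sub_zpow_mem (by rwa [← dvd_neg, neg_sub])) (hc i).mem.1
  · simp only [wpParams, Sum.elim_inr, sub_self, zero_mem]

/-- The value c = 1 gives the two parameters q^u and q^r, and each contributes a factor 1 - q^m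
beyond M. Hence truncating at M or at m - 1 makes no difference modulo the square. -/
theorem wpTerm_mem_multiplesIn (h : IsCycloSubring O m q) (hmd : IsCoprime (m : ℤ) d)
    (hc : ∀ i, IsParam O q (c i)) {i₀ : Fin 3} (hi₀ : c i₀ = 1) (hu : (m : ℤ) ∣ u - r)
    (hrM : (m : ℤ) ∣ r + d * M) {k : ℕ} (hMk : M < k) (hk : k < m) :
    wpTerm (q ^ r) (q ^ d) (wpParams q c r u) k ∈ multiplesIn O ((1 - q ^ m) * (1 - q ^ m)) := by
  have hq := (pow_mem h.q_mem d).1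
  rw [wpTerm, Fintype.prod_sum_type]
  refine multiplesIn_mul_left (multiplesIn_mul ?_ ?_)
    (wpCoef_mem hq (zpow_mem_unitsIn h.q_mem r).1 k)
  · refine prod_mem_multiplesIn (Finset.mem_univ i₀)
      (fun i _ => h.wpQuot_wpParams_mem hmd hc hu hk (Sum.inl i)) ?_
    simp only [wpParams, Sum.elim_inl, hi₀, one_mul]
    exact h.wpQuot_mem_multiplesIn hmd hu hrM hMk hk
  · refine prod_mem_multiplesIn (Finset.mem_univ i₀)
      (fun i _ => h.wpQuot_wpParams_mem hmd hc hu hk (Sum.inr i)) ?_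
    simp only [wpParams, Sum.elim_inr, hi₀, inv_one, one_mul]
    exact h.wpQuot_mem_multiplesIn hmd (by simp) hrM hMk hk

end IsCycloSubring

/-! ### Periodicity modulo `1 - q ^ m` -/

theorem wpQuot_add (A Q b : F) (N k : ℕ) : wpQuot A Q b (N + k) = wpQuot A Q b N *
    ∏ j ∈ Finset.range k, (1 - b * Q ^ (N + j)) / (b - A * Q ^ (N + j + 1)) :=
  Finset.prod_range_add _ _ _

theorem wpCoef_add (A Q : F) (N k : ℕ) : wpCoef A Q (N + k)
    = (A ^ 3 * Q ^ 2) ^ N * ((1 - A * Q ^ (2 * (N + k))) * (A ^ 3 * Q ^ 2) ^ k) := by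
  rw [wpCoef]; ring

namespace IsCycloSubring

theorem prod_shift_sub_mem (h : IsCycloSubring O m q) (hmd : IsCoprime (m : ℤ) d)
    {c : F} (hc : IsParam O q c) (l : ℕ) {k : ℕ} (hk : k < m) :
    (∏ j ∈ Finset.range k, (1 - c * q ^ r * (q ^ d) ^ (l * m + j)) /
        (c * q ^ r - q ^ r * (q ^ d) ^ (l * m + j + 1)))
      - wpQuot (q ^ r) (q ^ d) (c * q ^ r) k ∈ multiplesIn O (1 - q ^ m) ∧
    (∏ j ∈ Finset.range k, (1 - c * q ^ r * (q ^ d) ^ (l * m + j)) /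
        (c * q ^ r - q ^ r * (q ^ d) ^ (l * m + j + 1))) ∈ O := by
  have hru : (m : ℤ) ∣ r - r := by simp
  have hr := (zpow_mem_unitsIn h.q_mem r).1
  have hd1 : ∀ j < k, c * q ^ r - q ^ r * (q ^ d) ^ (l * m + j + 1) ∈ unitsIn O := fun j hj =>
    h.den_mem hmd hc hru fun hd => by
      push_cast at hd
      rw [add_assoc, Int.dvd_add_right (Dvd.intro_left _ rfl)] at hd
      have := Int.le_of_dvd (by omega) hd
      omega
  have hd2 : ∀ j < k, c * q ^ r - q ^ r * (q ^ d) ^ (j + 1) ∈ unitsIn O := fun j hj =>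
    h.den_mem hmd hc hru fun hd => by
      have := Int.le_of_dvd (by omega) hd
      omega
  have hp : ∀ j : ℕ, (q ^ d) ^ (l * m + j) - (q ^ d) ^ j ∈ multiplesIn O (1 - q ^ m) := fun j => by
    have := h.zpow_sub_zpow_mem (e := d * (l * m + j)) (e' := d * j)
      ⟨d * l, by ring⟩
    rw [← pow_mul, ← pow_mul]
    exact_mod_cast this
  have hO : ∀ j < k, (1 - c * q ^ r * (q ^ d) ^ (l * m + j)) /
        (c * q ^ r - q ^ r * (q ^ d) ^ (l * m + j + 1)) ∈ O := fun j hj =>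
    div_mem_of_mem_unitsIn (h.num_mem hc r _) (hd1 j hj)
  refine ⟨prod_sub_prod_mem_multiplesIn _ (fun j hj => hO j (Finset.mem_range.mp hj))
    (fun j hj => ?_) fun j hj => ?_, prod_mem fun j hj => hO j (Finset.mem_range.mp hj)⟩ <;>
    rw [Finset.mem_range] at hj
  · exact div_mem_of_mem_unitsIn (h.num_mem hc r _) (hd2 j hj)
  · refine div_sub_div_mem_multiplesIn ?_ ?_ (h.num_mem hc r _) (hd1 j hj) (hd2 j hj)
    · rw [sub_sub_sub_cancel_left, ← mul_sub]
      exact multiplesIn_mul_left (by rw [← neg_sub ((q ^ d) ^ _)]; exact neg_mem (hp j))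
        (mul_mem hc.mem.1 hr)
    · rw [sub_sub_sub_cancel_left, ← mul_sub]
      exact multiplesIn_mul_left (by rw [← neg_sub ((q ^ d) ^ _)]; exact neg_mem (hp (j + 1))) hr

/-- After the common factor 1 - q^m is cancelled, the denominator is the geometric sum of t powers
of q^m, a unit. -/
theorem one_sub_zpow_div_mem (h : IsCycloSubring O m q) {e : ℤ} (he : (m : ℤ) ∣ e) {t : ℕ}
    (ht : 0 < t) : (1 - q ^ e) / (1 - (q ^ m) ^ t) ∈ O := by
  obtain ⟨x, hx, hx'⟩ := h.one_sub_zpow_mem_of_dvd he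
  have h1 : 1 - q ^ m ≠ 0 := sub_ne_zero.mpr h.ne_one.symm
  rw [← hx', ← mul_neg_geom_sum (q ^ m) t, AddMonoidHom.coe_mulLeft, mul_div_mul_left _ _ h1]
  exact div_mem_of_mem_unitsIn hx (h.geom t ht)

/-- For generic c every denominator is a unit. For c = 1 each block of m factors has one non-unit
denominator, the last, and it is compensated by the numerator at position M of the same block. -/
theorem wpQuot_mul_mem (h : IsCycloSubring O m q) (hm : 0 < m) (hmd : IsCoprime (m : ℤ) d)
    (hd : 0 < d) (hM : M < m) (hrM : (m : ℤ) ∣ r + d * M) {c : F} (hc : IsParam O q c) (l : ℕ) :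
    wpQuot (q ^ r) (q ^ d) (c * q ^ r) (l * m) ∈ O := by
  have hru : (m : ℤ) ∣ r - r := by simp
  have hqr := zpow_mem_unitsIn h.q_mem r
  rcases hc.generic with rfl | hg
  · induction l with
    | zero => simp [wpQuot, O.one_mem]
    | succ l ih =>
      rw [Nat.succ_mul, wpQuot_add]
      refine mul_mem ih ?_
      have key : ∀ x E D y : F, x * E / (D * y) = x / y * (E / D) := fun x E D y => by
        rw [mul_comm D, mul_div_mul_comm]
      obtain ⟨s, rfl⟩ : ∃ s, m = s + 1 := ⟨m - 1, by omega⟩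
      rw [Finset.prod_div_distrib,
        Finset.prod_range_succ (fun j => 1 * q ^ r - q ^ r * (q ^ d) ^ (l * (s + 1) + j + 1)),
        ← Finset.mul_prod_erase _ _ (Finset.mem_range.mpr hM), key]
      refine mul_mem ?_ (div_mem_of_mem_unitsIn (prod_mem fun j _ => h.num_mem hc r _)
        (prod_mem fun j hj => h.den_mem hmd hc hru fun hdvd => ?_))
      · have e1 : 1 - 1 * q ^ r * (q ^ d) ^ (l * (s + 1) + M)
            = 1 - q ^ (r + d * M + (s + 1 : ℕ) * (d * l)) := by
          rw [one_mul, ← pow_mul, ← zpow_natCast q (d * _), ← zpow_add₀ h.q_mem.2.2]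
          congr 2; push_cast; ring
        have e2 : 1 * q ^ r - q ^ r * (q ^ d) ^ (l * (s + 1) + s + 1)
            = q ^ r * (1 - (q ^ (s + 1)) ^ (d * (l + 1))) := by
          rw [one_mul, mul_sub, mul_one, ← pow_mul, ← pow_mul]
          congr 3; ring
        rw [e1, e2, div_mul_eq_div_div_swap]
        exact div_mem_of_mem_unitsIn (h.one_sub_zpow_div_mem
          (dvd_add hrM (Dvd.intro _ rfl)) (by positivity)) hqr
      · rw [Finset.mem_range] at hj
        push_cast at hdvd
        rw [add_assoc, Int.dvd_add_right (Dvd.intro_left _ rfl)] at hdvd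
        have := Int.le_of_dvd (by omega) hdvd
        omega
  · refine prod_mem fun j _ => div_mem_of_mem_unitsIn (h.num_mem hc r j) ?_
    have e : c * q ^ r - q ^ r * (q ^ d) ^ (j + 1)
        = -(q ^ r * (q ^ d) ^ (j + 1)) * (1 - c * q ^ (-(d * (j + 1 : ℕ)) : ℤ)) := by
      have e2 : q ^ (-(d * (j + 1 : ℕ)) : ℤ) * (q ^ d) ^ (j + 1) = 1 := by
        rw [← pow_mul, ← zpow_natCast q (d * (j + 1)), ← zpow_add₀ h.q_mem.2.2]
        push_cast
        simp
      linear_combination (-c * q ^ r) * e2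
    rw [e]
    exact mul_mem (neg_mem_unitsIn (mul_mem hqr (pow_mem (pow_mem h.q_mem d) _))) (hg _)

/-- Split off the first l m factors as G; the remaining ones involve Q only through powers, and
Q^(lm) ≡ 1. Only the integrality of G matters later. -/
theorem wpTerm_shift_sub_mem (h : IsCycloSubring O m q) (hmd : IsCoprime (m : ℤ) d)
    (hd : 0 < d) (hM : M < m) (hrM : (m : ℤ) ∣ r + d * M) {c : Fin 3 → F}
    (hc : ∀ i, IsParam O q (c i)) (l : ℕ) :
    ∃ G ∈ O, ∀ k < m, wpTerm (q ^ r) (q ^ d) (wpParams q c r r) (l * m + k)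
      - G * wpTerm (q ^ r) (q ^ d) (wpParams q c r r) k ∈ multiplesIn O (1 - q ^ m) := by
  have hq := pow_mem h.q_mem d
  have hr := zpow_mem_unitsIn h.q_mem r
  have hAQ : (q ^ r) ^ 3 * (q ^ d) ^ 2 ∈ O := mul_mem (pow_mem hr.1 _) (pow_mem hq.1 _)
  have hparam : ∀ i, ∃ c', IsParam O q c' ∧ wpParams q c r r i = c' * q ^ r := fun i => by
    rcases i with i | i
    · exact ⟨c i, hc i, rfl⟩
    · exact ⟨(c i)⁻¹, (hc i).inv h.q_mem, rfl⟩
  choose c' hc' hcc' using hparam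
  refine ⟨((q ^ r) ^ 3 * (q ^ d) ^ 2) ^ (l * m) *
    ∏ i, wpQuot (q ^ r) (q ^ d) (wpParams q c r r i) (l * m),
    mul_mem (pow_mem hAQ _) (prod_mem fun i _ => ?_), fun k hk => ?_⟩
  · rw [hcc']
    exact h.wpQuot_mul_mem (by omega) hmd hd hM hrM (hc' i) l
  have hV : ∏ i, wpQuot (q ^ r) (q ^ d) (wpParams q c r r i) (l * m) ∈ O :=
    prod_mem fun i _ => by
      rw [hcc']
      exact h.wpQuot_mul_mem (by omega) hmd hd hM hrM (hc' i) l
  rw [wpTerm, wpTerm, wpCoef_add]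
  simp only [wpQuot_add, Finset.prod_mul_distrib]
  set V := ∏ i, wpQuot (q ^ r) (q ^ d) (wpParams q c r r i) (l * m)
  have e1 : ∀ x y z u v : F, x * y * (V * z) - x * V * (u * v) = x * V * (y * z - u * v) := by
    intros; ring
  rw [e1]
  refine multiplesIn_mul_left (mul_sub_mul_mem_multiplesIn ?_ ?_ (wpCoef_mem hq.1 hr.1 k) ?_)
    (mul_mem (pow_mem hAQ _) hV)
  · rw [wpCoef, ← sub_mul, sub_sub_sub_cancel_left, ← mul_sub]
    refine multiplesIn_mul_right (multiplesIn_mul_left ?_ hr.1) (pow_mem hAQ k)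
    have := h.zpow_sub_zpow_mem (e := d * (2 * k)) (e' := d * (2 * (l * m + k)))
      ⟨-(d * 2 * l), by ring⟩
    rw [← pow_mul, ← pow_mul]
    exact_mod_cast this
  · refine prod_sub_prod_mem_multiplesIn _ (fun i _ => ?_) (fun i _ => ?_) fun i _ => ?_
    · rw [hcc']; exact (h.prod_shift_sub_mem hmd (hc' i) l hk).2
    · exact h.wpQuot_wpParams_mem hmd hc (by simp) hk i
    · rw [hcc']; exact (h.prod_shift_sub_mem hmd (hc' i) l hk).1
  · refine prod_mem fun i _ => ?_
    rw [hcc']; exact (h.prod_shift_sub_mem hmd (hc' i) l hk).2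

theorem sum_wpTerm_period_mem (h : IsCycloSubring O m q) (hmd : IsCoprime (m : ℤ) d)
    (hM : M < m) (hrM : (m : ℤ) ∣ r + d * M) {c : Fin 3 → F} (hc : ∀ i, IsParam O q (c i))
    {i₀ : Fin 3} (hi₀ : c i₀ = 1) :
    ∑ k ∈ Finset.range m, wpTerm (q ^ r) (q ^ d) (wpParams q c r r) k
      ∈ multiplesIn O (1 - q ^ m) := by
  rw [← Finset.sum_range_add_sum_Ico _ (show M + 1 ≤ m from hM)]
  refine add_mem (h.sum_wpTerm_mem hmd hc (by simp) hM hrM) (sum_mem fun k hk => ?_)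
  rw [Finset.mem_Ico] at hk
  obtain ⟨x, hx, hx'⟩ := h.wpTerm_mem_multiplesIn hmd hc hi₀ (u := r) (by simp) hrM hk.1 hk.2
  -- The tail is a multiple of the square; one of the two factors is absorbed into the cofactor.
  refine ⟨(1 - q ^ m) * x, O.mul_mem (sub_mem O.one_mem (pow_mem h.q_mem.1 m)) hx, ?_⟩
  rw [← hx']
  simp [mul_assoc]

theorem sum_wpTerm_periods_mem (h : IsCycloSubring O m q) (hmd : IsCoprime (m : ℤ) d)
    (hd : 0 < d) (hM : M < m) (hrM : (m : ℤ) ∣ r + d * M) {c : Fin 3 → F}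
    (hc : ∀ i, IsParam O q (c i)) {i₀ : Fin 3} (hi₀ : c i₀ = 1) (l : ℕ) {N : ℕ}
    (hN : N = 0 ∨ N = M + 1) :
    ∑ k ∈ Finset.range (l * m + N), wpTerm (q ^ r) (q ^ d) (wpParams q c r r) k
      ∈ multiplesIn O (1 - q ^ m) := by
  have hblock : ∀ (l N' : ℕ), N' ≤ m →
      ∑ k ∈ Finset.range N', wpTerm (q ^ r) (q ^ d) (wpParams q c r r) k
        ∈ multiplesIn O (1 - q ^ m) →
      ∑ k ∈ Finset.range N', wpTerm (q ^ r) (q ^ d) (wpParams q c r r) (l * m + k)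
        ∈ multiplesIn O (1 - q ^ m) := by
    intro l N' hN' hs
    obtain ⟨G, hG, hk⟩ := h.wpTerm_shift_sub_mem hmd hd hM hrM hc l
    have h1 : ∑ k ∈ Finset.range N', (wpTerm (q ^ r) (q ^ d) (wpParams q c r r) (l * m + k)
        - G * wpTerm (q ^ r) (q ^ d) (wpParams q c r r) k) ∈ multiplesIn O (1 - q ^ m) :=
      sum_mem fun k hk' => hk k (by rw [Finset.mem_range] at hk'; omega)
    rw [Finset.sum_sub_distrib, ← Finset.mul_sum] at h1
    simpa using add_mem h1 (multiplesIn_mul_left hs hG)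
  have hfull : ∑ k ∈ Finset.range (l * m), wpTerm (q ^ r) (q ^ d) (wpParams q c r r) k
      ∈ multiplesIn O (1 - q ^ m) := by
    induction l with
    | zero => simp
    | succ l ih =>
      rw [Nat.succ_mul, Finset.sum_range_add]
      exact add_mem ih (hblock l m le_rfl (h.sum_wpTerm_period_mem hmd hM hrM hc hi₀))
  rw [Finset.sum_range_add]
  refine add_mem hfull ?_
  rcases hN with rfl | rfl
  · simp
  · exact hblock l _ hM (h.sum_wpTerm_mem hmd hc (by simp) hM hrM)

end IsCycloSubring

end Cyclotomic

/-! ### Polynomial functions with coefficients in O and bounded degree -/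

section PolynomialFunctions

variable {F : Type*} [Field F] {O : Subring F}

/-- Functions given by a polynomial of degree at most `D` with coefficients in `O`. -/
def IsPolyIn (O : Subring F) (D : ℕ) (f : F → F) : Prop :=
  ∃ P : Polynomial O, P.natDegree ≤ D ∧ ∀ y, f y = P.eval₂ O.subtype y

theorem IsPolyIn.mul {D E : ℕ} {f g : F → F} (hf : IsPolyIn O D f) (hg : IsPolyIn O E g) :
    IsPolyIn O (D + E) (fun y => f y * g y) := by
  obtain ⟨P, hP, hP'⟩ := hf
  obtain ⟨R, hR, hR'⟩ := hg
  exact ⟨P * R, Polynomial.natDegree_mul_le_of_le hP hR, fun y => by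
    rw [Polynomial.eval₂_mul, ← hP', ← hR']⟩

theorem IsPolyIn.one : IsPolyIn O 0 (fun _ => 1) := ⟨1, by simp, by simp⟩

theorem isPolyIn_one_sub_mul_pow {c : F} (hc : c ∈ O) (D : ℕ) :
    IsPolyIn O D (fun y => 1 - c * y ^ D) := by
  refine ⟨1 - Polynomial.C ⟨c, hc⟩ * Polynomial.X ^ D, ?_, fun y => ?_⟩
  · refine (Polynomial.natDegree_sub_le _ _).trans ?_
    simpa using Polynomial.natDegree_C_mul_X_pow_le _ _
  · simp [Polynomial.eval₂_sub, Polynomial.eval₂_mul]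

theorem isPolyIn_prod {ι : Type*} (s : Finset ι) {D : ℕ} {f : ι → F → F}
    (h : ∀ i ∈ s, IsPolyIn O D (f i)) : IsPolyIn O (s.card * D) (fun y => ∏ i ∈ s, f i y) := by
  classical
  induction s using Finset.induction_on with
  | empty => simpa using IsPolyIn.one
  | insert i s hi ih =>
    simp only [Finset.mem_insert, forall_eq_or_imp] at h
    have := h.1.mul (ih h.2)
    rw [Finset.card_insert_of_notMem hi, Nat.succ_mul, add_comm]
    simpa only [Finset.prod_insert hi] using this

theorem isPolyIn_qPoch {x Q : F} (hx : x ∈ O) (hQ : Q ∈ O) (j : ℕ) :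
    IsPolyIn O j (fun y => qPoch (x * y) Q j) := by
  have := isPolyIn_prod (O := O) (Finset.range j) (D := 1)
    (f := fun i y => 1 - x * Q ^ i * y ^ 1)
    fun i _ => isPolyIn_one_sub_mul_pow (mul_mem hx (pow_mem hQ i)) 1
  simpa [qPoch, mul_right_comm] using this

theorem IsPolyIn.exists_sum {D : ℕ} {f : F → F} (hf : IsPolyIn O D f) :
    ∃ g : ℕ → F, (∀ s, g s ∈ O) ∧ ∀ y, f y = ∑ s ∈ Finset.range (D + 1), g s * y ^ s := by
  obtain ⟨P, hP, hP'⟩ := hf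
  refine ⟨fun s => P.coeff s, fun s => (P.coeff s).2, fun y => ?_⟩
  rw [hP', Polynomial.eval₂_eq_sum_range' O.subtype (Nat.lt_succ_of_le hP)]
  rfl

end PolynomialFunctions

/-! ### Reversal of q-shifted factorials and the antisymmetric Laurent polynomial -/

section QPochhammer

variable {F : Type*} [Field F]

theorem qPoch_add (x Q : F) (k j : ℕ) :
    qPoch x Q (k + j) = qPoch x Q k * qPoch (x * Q ^ k) Q j := by
  simp only [qPoch, Finset.prod_range_add, pow_add, mul_assoc]

theorem qPoch_mul_qPoch_comm (x Q : F) (k j : ℕ) :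
    qPoch x Q k * qPoch (x * Q ^ k) Q j = qPoch x Q j * qPoch (x * Q ^ j) Q k := by
  rw [← qPoch_add, ← qPoch_add, add_comm]

/-- Reading the product backwards, x Q^(j-1-t) is the inverse of x' Q^t, and (1 - 1/z) z = -(1 - z).
-/
theorem qPoch_reflect {x x' Q : F} (j : ℕ) (h : x * x' * Q ^ j = Q) (hQ : Q ≠ 0) :
    qPoch x Q j * ∏ t ∈ Finset.range j, (x' * Q ^ t) = (-1) ^ j * qPoch x' Q j := by
  rw [qPoch, ← Finset.prod_range_reflect, ← Finset.prod_mul_distrib, qPoch]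
  rw [show (-1 : F) ^ j = ∏ _t ∈ Finset.range j, -1 by simp, ← Finset.prod_mul_distrib]
  refine Finset.prod_congr rfl fun t ht => ?_
  rw [Finset.mem_range] at ht
  have e : Q ^ j = Q ^ (j - 1 - t) * Q ^ t * Q := by
    rw [← pow_add, ← pow_succ]; congr 1; omega
  rw [e, ← mul_assoc] at h
  have h1 : x * x' * (Q ^ (j - 1 - t) * Q ^ t) = 1 := mul_right_cancel₀ hQ (by rw [h, one_mul])
  linear_combination -h1

/-- For two reversed products the signs cancel, and pairing t with j - 1 - t makes each pair of
monomials equal to z. -/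
theorem qPoch_pair_reflect {x₁ x₁' x₂ x₂' Q z : F} (j : ℕ) (h₁ : x₁ * x₁' * Q ^ j = Q)
    (h₂ : x₂ * x₂' * Q ^ j = Q) (hQ : Q ≠ 0)
    (hz : x₁' * x₂' * Q ^ j = z * Q) :
    qPoch x₁ Q j * qPoch x₂ Q j * z ^ j = qPoch x₁' Q j * qPoch x₂' Q j := by
  have e : (∏ t ∈ Finset.range j, (x₁' * Q ^ t)) * ∏ t ∈ Finset.range j, (x₂' * Q ^ t)
      = z ^ j := by
    rw [← Finset.prod_range_reflect, ← Finset.prod_mul_distrib,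
      show z ^ j = ∏ _t ∈ Finset.range j, z by simp]
    refine Finset.prod_congr rfl fun t ht => ?_
    rw [Finset.mem_range] at ht
    have e : Q ^ j = Q ^ (j - 1 - t) * Q ^ t * Q := by
      rw [← pow_add, ← pow_succ]; congr 1; omega
    rw [e, ← mul_assoc] at hz
    have := mul_right_cancel₀ hQ hz
    linear_combination this
  have e1 := qPoch_reflect j h₁ hQ
  have e2 := qPoch_reflect j h₂ hQ
  have e3 : (-1 : F) ^ j * (-1) ^ j = 1 := by rw [← mul_pow]; simp
  calc _ = (qPoch x₁ Q j * ∏ t ∈ Finset.range j, (x₁' * Q ^ t))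
        * (qPoch x₂ Q j * ∏ t ∈ Finset.range j, (x₂' * Q ^ t)) := by rw [← e]; ring
    _ = ((-1 : F) ^ j * (-1) ^ j) * (qPoch x₁' Q j * qPoch x₂' Q j) := by rw [e1, e2]; ring
    _ = _ := by rw [e3, one_mul]

theorem wpQuot_eq_qPoch {A Q b : F} (hb : b ≠ 0) (k : ℕ) :
    wpQuot A Q b k * b ^ k = qPoch b Q k / qPoch (A * Q / b) Q k := by
  rw [wpQuot, qPoch, qPoch, ← Finset.prod_div_distrib, show b ^ k = ∏ _j ∈ Finset.range k, b by simp,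
    ← Finset.prod_mul_distrib]
  refine Finset.prod_congr rfl fun j _ => ?_
  have e : b - A * Q ^ (j + 1) = b * (1 - A * Q / b * Q ^ j) := by field_simp; ring
  rw [e, div_mul_eq_mul_div, mul_comm (1 - b * Q ^ j), mul_div_mul_left _ _ hb]

/-- The Laurent polynomial whose values at the powers of `Q` are the terms of the deformed
series, up to a constant factor. -/
def wpPoly (A Q w : F) (c : Fin 3 → F) (j : ℕ) (y : F) : F :=
  (1 - A * y ^ 2) * (∏ i, (qPoch (c i * Q * y) Q j * qPoch (w * Q / c i * y) Q j))
    / y ^ (3 * j + 1)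

/-- Under y ↦ 1/(Ay) the two factors attached to c i change places, up to a power of A y². The sign
comes from 1 - A y², and the denominator y^(3j+1) balances the powers. -/
theorem wpPoly_reflect {A Q w y : F} {c : Fin 3 → F} {j : ℕ} (hA : A = w * Q ^ (j + 1))
    (hw : w ≠ 0) (hQ : Q ≠ 0) (hy : y ≠ 0) (hc : ∀ i, c i ≠ 0) :
    wpPoly A Q w c j (A * y)⁻¹ = -wpPoly A Q w c j y := by
  have hA0 : A ≠ 0 := by rw [hA]; positivity
  have hp : (∏ i, (qPoch (c i * Q * (A * y)⁻¹) Q j * qPoch (w * Q / c i * (A * y)⁻¹) Q j))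
        * (A * y ^ 2) ^ (3 * j)
      = ∏ i, (qPoch (c i * Q * y) Q j * qPoch (w * Q / c i * y) Q j) := by
    rw [mul_comm 3 j, pow_mul, show ((A * y ^ 2) ^ j) ^ 3 = ∏ _i : Fin 3, (A * y ^ 2) ^ j by simp,
      ← Finset.prod_mul_distrib]
    refine Finset.prod_congr rfl fun i _ => ?_
    have := hc i
    rw [mul_comm (qPoch (c i * Q * y) Q j)]
    refine qPoch_pair_reflect j ?_ ?_ hQ ?_ <;> rw [hA] <;>
      field_simp <;> ring
  have ht : A * y ^ 2 ≠ 0 := by positivity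
  rw [wpPoly, wpPoly, ← hp]
  set R := ∏ i, (qPoch (c i * Q * (A * y)⁻¹) Q j * qPoch (w * Q / c i * (A * y)⁻¹) Q j)
  rw [inv_pow _ (3 * j + 1), div_inv_eq_mul, ← neg_div, eq_div_iff (by positivity)]
  have e : (A * y) ^ (3 * j + 1) * y ^ (3 * j + 1) = (A * y ^ 2) ^ (3 * j) * (A * y ^ 2) := by
    rw [← mul_pow, ← pow_succ]; ring
  rw [mul_assoc, e]
  field_simp
  ring

end QPochhammer

/-! ### The deformed series modulo (1 - q^n)² -/

section Deformed

variable {F : Type*} [Field F] {O : Subring F} {n d j : ℕ} {q : F} {r : ℤ} {c : Fin 3 → F}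

theorem qPoch_mem {x Q : F} (hx : x ∈ O) (hQ : Q ∈ O) (k : ℕ) : qPoch x Q k ∈ O :=
  prod_mem fun _ _ => sub_mem O.one_mem (mul_mem hx (pow_mem hQ _))

namespace IsCycloSubring

theorem qPoch_mem_multiplesIn (h : IsCycloSubring O n q) {e : ℤ} {t k : ℕ} (ht : t < k)
    (he : (n : ℤ) ∣ e + d * t) :
    qPoch (q ^ e) (q ^ d) k ∈ multiplesIn O (1 - q ^ n) := by
  refine prod_mem_multiplesIn (i := t) (Finset.mem_range.mpr ht) (fun i _ => ?_) ?_
  · exact sub_mem O.one_mem (mul_mem (zpow_mem_unitsIn h.q_mem e).1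
      (pow_mem (pow_mem h.q_mem d) i).1)
  · rw [← pow_mul, ← zpow_natCast q (d * t), ← zpow_add₀ h.q_mem.2.2]
    exact h.one_sub_zpow_mem_of_dvd (by exact_mod_cast he)

/-- The two factorials with c = 1 contain, at index t, the factors 1 - q^x and 1 - q^(x-n) with x =
d(1 + e + t), a multiple of n. -/
theorem wpPoly_mem_multiplesIn (h : IsCycloSubring O n q) (hc : ∀ i, IsParam O q (c i))
    {i₀ : Fin 3} (hi₀ : c i₀ = 1) {e : ℤ} {t : ℕ} (ht : t < j) (he : (n : ℤ) ∣ e + (t + 1)) :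
    wpPoly (q ^ r) (q ^ d) (q ^ (-n : ℤ)) c j ((q ^ d) ^ e)
      ∈ multiplesIn O ((1 - q ^ n) * (1 - q ^ n)) := by
  have hq := h.q_mem
  have hQ := pow_mem hq d
  have hy := zpow_mem_unitsIn hQ e
  have hw := zpow_mem_unitsIn hq (-n : ℤ)
  have hr := zpow_mem_unitsIn hq r
  have he' : (n : ℤ) ∣ d * (1 + e) + d * t := by
    rw [← mul_add, show 1 + e + t = e + (t + 1 : ℤ) by ring]; exact Dvd.dvd.mul_left he _
  refine multiplesIn_div (multiplesIn_mul_left ?_ (sub_mem O.one_mem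
    (mul_mem hr.1 (pow_mem hy.1 2)))) (pow_mem hy _)
  rw [← Finset.mul_prod_erase _ _ (Finset.mem_univ i₀)]
  refine multiplesIn_mul_right (multiplesIn_mul ?_ ?_) (prod_mem fun i _ => mul_mem ?_ ?_)
  · rw [hi₀, one_mul, ← zpow_natCast q d, ← zpow_mul, ← zpow_add₀ hq.2.2, zpow_natCast]
    refine h.qPoch_mem_multiplesIn ht ?_
    rwa [show (d : ℤ) + d * e = d * (1 + e) by ring]
  · rw [hi₀, div_one, ← zpow_natCast q d, ← zpow_mul, ← zpow_add₀ hq.2.2, ← zpow_add₀ hq.2.2,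
      zpow_natCast]
    refine h.qPoch_mem_multiplesIn ht ?_
    rw [show -(n : ℤ) + d + d * e + d * t = d * (1 + e) + d * t - n by ring]
    exact dvd_sub he' dvd_rfl
  · exact qPoch_mem (mul_mem (mul_mem (hc i).mem hQ) hy).1 hQ.1 j
  · exact qPoch_mem (mul_mem (div_mem_unitsIn (mul_mem hw hQ) (hc i).mem) hy).1 hQ.1 j

/-- A sum of a Laurent polynomial over a full period of powers of `Q` changes only modulo the
square of `1 - q ^ n` when the argument is multiplied by a power of `q ^ n`. -/
theorem sum_laurent_sub_mem (h : IsCycloSubring O n q) (hnd : IsCoprime (n : ℤ) d) {N : ℕ}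
    (hN : N < n) (g : ℕ → F) (hg : ∀ s, g s ∈ O) (a : ℤ) {θ : ℤ} (hθ : (n : ℤ) ∣ θ) :
    ∑ k ∈ Finset.range n,
      (∑ s ∈ Finset.range (2 * N + 1), g s * ((q ^ d) ^ ((k : ℤ) + a)) ^ ((s : ℤ) - N)
      - ∑ s ∈ Finset.range (2 * N + 1), g s * (q ^ θ * (q ^ d) ^ ((k : ℤ) + a)) ^ ((s : ℤ) - N))
      ∈ multiplesIn O ((1 - q ^ n) * (1 - q ^ n)) := by
  have hq := h.q_mem
  have hQ := pow_mem hq d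
  have e1 : ∀ k s : ℕ, g s * ((q ^ d) ^ ((k : ℤ) + a)) ^ ((s : ℤ) - N)
      - g s * (q ^ θ * (q ^ d) ^ ((k : ℤ) + a)) ^ ((s : ℤ) - N)
      = g s * (q ^ d) ^ (a * ((s : ℤ) - N)) *
        ((1 - q ^ (θ * ((s : ℤ) - N))) * ((q ^ d) ^ ((s : ℤ) - N)) ^ k) := by
    intro k s
    rw [mul_zpow, ← zpow_mul q θ, ← zpow_mul, add_mul, zpow_add₀ hQ.2.2, ← zpow_natCast _ k,
      ← zpow_mul, mul_comm (k : ℤ)]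
    ring
  simp only [← Finset.sum_sub_distrib, e1]
  rw [Finset.sum_comm]
  refine sum_mem fun s hs => ?_
  rw [Finset.mem_range] at hs
  rw [← Finset.mul_sum, ← Finset.mul_sum]
  refine multiplesIn_mul_left ?_ (mul_mem (hg s) (zpow_mem_unitsIn hQ _).1)
  rcases eq_or_ne ((s : ℤ) - N) 0 with h0 | h0
  · simp [h0, zero_mem]
  -- One factor comes from scaling by q^θ, the other from the geometric sum: its ratio Q^(s-N) is
  -- not 1 at the root of unity because 0 < |s - N| < n, but the n-th power of the ratio is.
  · refine multiplesIn_mul (h.one_sub_zpow_mem_of_dvd (Dvd.dvd.mul_right hθ _)) ?_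
    have hu : 1 - (q ^ d) ^ ((s : ℤ) - N) ∈ unitsIn O := by
      rw [← zpow_natCast q d, ← zpow_mul]
      refine h.one_sub _ fun hd => h0 ?_
      have := hnd.dvd_of_dvd_mul_left hd
      exact Int.eq_zero_of_abs_lt_dvd this (by rw [abs_lt]; omega)
    refine mem_multiplesIn_of_mul_mem hu ?_
    rw [mul_neg_geom_sum, ← zpow_natCast q d, ← zpow_mul,
      ← zpow_natCast (q ^ ((d : ℤ) * ((s : ℤ) - N))), ← zpow_mul]
    exact h.one_sub_zpow_mem_of_dvd (Dvd.intro_left _ rfl)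

theorem sum_wpPoly_mem (h : IsCycloSubring O n q) (hnd : IsCoprime (n : ℤ) d)
    (hc : ∀ i, IsParam O q (c i)) {i₀ : Fin 3} (hi₀ : c i₀ = 1)
    (hdj : (d : ℤ) * (j + 1) = n + r) (hj : 3 * j + 1 < n) :
    ∑ k ∈ Finset.range n, wpPoly (q ^ r) (q ^ d) (q ^ (-n : ℤ)) c j ((q ^ d) ^ (k : ℤ))
      ∈ multiplesIn O ((1 - q ^ n) * (1 - q ^ n)) := by
  have hq := h.q_mem
  have hQ := pow_mem hq d
  have hw := zpow_mem_unitsIn hq (-n : ℤ)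
  have hr := zpow_mem_unitsIn hq r
  set p := wpPoly (q ^ r) (q ^ d) (q ^ (-n : ℤ)) c j with hp
  have hpoly : IsPolyIn O (2 * (3 * j + 1)) (fun y => (1 - q ^ r * y ^ 2) *
      ∏ i, (qPoch (c i * q ^ d * y) (q ^ d) j * qPoch (q ^ (-n : ℤ) * q ^ d / c i * y) (q ^ d) j)) := by
    have := (isPolyIn_one_sub_mul_pow hr.1 2).mul (isPolyIn_prod (O := O) Finset.univ (D := j + j)
      (f := fun i y => qPoch (c i * q ^ d * y) (q ^ d) j *
        qPoch (q ^ (-n : ℤ) * q ^ d / c i * y) (q ^ d) j) fun i _ =>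
        (isPolyIn_qPoch (mul_mem (hc i).mem hQ).1 hQ.1 j).mul
        (isPolyIn_qPoch (div_mem_unitsIn (mul_mem hw hQ) (hc i).mem).1 hQ.1 j))
    rw [Finset.card_univ, Fintype.card_fin, show 2 + 3 * (j + j) = 2 * (3 * j + 1) by ring] at this
    exact this
  obtain ⟨g, hg, hg'⟩ := hpoly.exists_sum
  have hpg : ∀ y, y ≠ 0 → p y
      = ∑ s ∈ Finset.range (2 * (3 * j + 1) + 1), g s * y ^ ((s : ℤ) - (3 * j + 1 : ℕ)) := by
    intro y hy
    rw [hp, wpPoly, hg', Finset.sum_div]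
    refine Finset.sum_congr rfl fun s _ => ?_
    rw [zpow_sub₀ hy, zpow_natCast, zpow_natCast, mul_div_assoc]
  -- Chosen so that A · q^θ Q^(k-j) · Q^(n-1-k) = 1, by d(j+1) = n + r.
  set θ : ℤ := n - d * n
  have hshift : ∀ t ≤ j, ∑ k ∈ Finset.range n, p ((q ^ d) ^ (k : ℤ))
      - ∑ k ∈ Finset.range n, p ((q ^ d) ^ ((k : ℤ) + -t))
      ∈ multiplesIn O ((1 - q ^ n) * (1 - q ^ n)) := by
    intro t
    induction t with
    | zero => simp [zero_mem]
    | succ t ih =>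
      intro ht
      -- Moving the window one place trades the value at exponent n - (t+1) for the one at -(t+1);
      -- both are multiples of the square.
      have h1 := Finset.sum_range_succ (fun k : ℕ => p ((q ^ d) ^ ((k : ℤ) + -(t + 1 : ℕ)))) n
      rw [Finset.sum_range_succ'] at h1
      have e1 : ∀ k : ℕ, ((k + 1 : ℕ) : ℤ) + -(t + 1 : ℕ) = k + -t := fun k => by push_cast; ring
      simp only [e1] at h1
      have h2 := h.wpPoly_mem_multiplesIn (r := r) (d := d) hc hi₀ (j := j) (t := t)
        (e := ((0 : ℕ) : ℤ) + -(t + 1 : ℕ)) ht (by simp)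
      have h3 := h.wpPoly_mem_multiplesIn (r := r) (d := d) hc hi₀ (j := j) (t := t)
        (e := (n : ℤ) + -(t + 1 : ℕ)) ht ⟨1, by push_cast; ring⟩
      have := add_mem (ih (by omega)) (sub_mem h3 h2)
      rw [← hp] at this
      convert this using 1
      linear_combination h1
  have hrefl : ∑ k ∈ Finset.range n, p ((q ^ d) ^ (k : ℤ))
      = -∑ k ∈ Finset.range n, p (q ^ θ * (q ^ d) ^ ((k : ℤ) + -j)) := by
    rw [← Finset.sum_range_reflect, ← Finset.sum_neg_distrib]
    refine Finset.sum_congr rfl fun k hk => ?_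
    rw [Finset.mem_range] at hk
    rw [← neg_eq_iff_eq_neg, hp, ← wpPoly_reflect _ hw.2.2 hQ.2.2 (zpow_ne_zero _ hQ.2.2)
      (fun i => (hc i).mem.2.2)]
    · congr 1
      rw [← zpow_natCast q d, ← zpow_mul, ← zpow_add₀ hq.2.2, ← zpow_neg, ← zpow_mul,
        ← zpow_add₀ hq.2.2]
      congr 1
      rw [show ((n - 1 - k : ℕ) : ℤ) = n - 1 - k by omega]
      linear_combination hdj
    · rw [← pow_mul, ← zpow_natCast q (d * _), ← zpow_add₀ hq.2.2]
      congr 1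
      push_cast
      linear_combination -hdj
  have hlaurent := h.sum_laurent_sub_mem hnd hj g hg (-j) (θ := θ)
    ⟨1 - d, by simp only [θ]; ring⟩
  refine mem_multiplesIn_of_mul_mem h.two_mem ?_
  have hperiod : ∑ k ∈ Finset.range n, (p ((q ^ d) ^ ((k : ℤ) + -j))
      - p (q ^ θ * (q ^ d) ^ ((k : ℤ) + -j))) ∈ multiplesIn O ((1 - q ^ n) * (1 - q ^ n)) := by
    have e : ∀ k : ℕ, p ((q ^ d) ^ ((k : ℤ) + -j)) - p (q ^ θ * (q ^ d) ^ ((k : ℤ) + -j)) = _ :=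
      fun k => congrArg₂ (· - ·) (hpg _ (zpow_ne_zero _ hQ.2.2))
        (hpg _ (mul_ne_zero (zpow_ne_zero _ hq.2.2) (zpow_ne_zero _ hQ.2.2)))
    rw [Finset.sum_congr rfl fun k _ => e k]
    exact hlaurent
  rw [Finset.sum_sub_distrib] at hperiod
  have h4 := add_mem (hshift j le_rfl) hperiod
  convert h4 using 1
  linear_combination hrefl

theorem qPoch_mem_unitsIn (h : IsCycloSubring O n q) (hnd : IsCoprime (n : ℤ) d) {c : F}
    (hc : IsParam O q c) {e : ℤ} (he : (n : ℤ) ∣ e - d) {k : ℕ} (hk : k < n) :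
    qPoch (c * q ^ e) (q ^ d) k ∈ unitsIn O := by
  refine prod_mem fun t ht => ?_
  rw [Finset.mem_range] at ht
  rw [mul_assoc, ← pow_mul, ← zpow_natCast q (d * t), ← zpow_add₀ h.q_mem.2.2]
  refine h.one_sub_param hc fun hd => ?_
  have h1 := dvd_sub hd he
  rw [show e + ((d * t : ℕ) : ℤ) - (e - d) = d * (t + 1) by push_cast; ring] at h1
  have := Int.le_of_dvd (by omega) (hnd.dvd_of_dvd_mul_left h1)
  omega

/-- Up to a constant factor that is a unit, the terms of the series with deformed parameters
are the values of `wpPoly` at the powers of `Q`. -/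
theorem wpTerm_eq_wpPoly (h : IsCycloSubring O n q) (hnd : IsCoprime (n : ℤ) d)
    (hc : ∀ i, IsParam O q (c i)) (hdj : (d : ℤ) * (j + 1) = n + r) {k : ℕ} (hk : k < n) :
    (∏ i, (qPoch (c i * q ^ d) (q ^ d) j * qPoch (q ^ (-n : ℤ) * q ^ d / c i) (q ^ d) j))
      * wpTerm (q ^ r) (q ^ d) (wpParams q c r (r + n)) k
      = wpPoly (q ^ r) (q ^ d) (q ^ (-n : ℤ)) c j ((q ^ d) ^ (k : ℤ)) := by
  have hq := h.q_mem.2.2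
  have hQ := (pow_mem h.q_mem d).2.2
  -- The reason for deforming by exactly n: numerator and denominator factorials now start j powers
  -- of Q apart, so their quotient is polynomial in Q^k.
  have hrn : q ^ (r + n) = (q ^ d) ^ (j + 1) := by
    rw [← pow_mul, ← zpow_natCast q (d * _)]; congr 1; push_cast; linear_combination -hdj
  have hwQ : q ^ r = q ^ (-n : ℤ) * (q ^ d) ^ (j + 1) := by
    rw [← hrn, ← zpow_add₀ hq]; congr 1; ring
  have hw : q ^ (-n : ℤ) ≠ 0 := zpow_ne_zero _ hq
  have hpair : ∀ i, (qPoch (c i * q ^ d) (q ^ d) j * qPoch (q ^ (-n : ℤ) * q ^ d / c i) (q ^ d) j)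
      * (wpQuot (q ^ r) (q ^ d) (c i * q ^ (r + n)) k * wpQuot (q ^ r) (q ^ d) ((c i)⁻¹ * q ^ r) k)
      * ((q ^ d) ^ (j + 1) * q ^ r) ^ k
      = qPoch (c i * q ^ d * (q ^ d) ^ k) (q ^ d) j
        * qPoch (q ^ (-n : ℤ) * q ^ d / c i * (q ^ d) ^ k) (q ^ d) j := by
    intro i
    have hci := (hc i).mem.2.2
    have hu₁ := (h.qPoch_mem_unitsIn hnd (hc i) (e := d) (by simp) hk).2.2
    have hu₂ := (h.qPoch_mem_unitsIn hnd ((hc i).inv h.q_mem) (e := -n + d) (by simp) hk).2.2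
    rw [zpow_natCast] at hu₁
    rw [zpow_add₀ hq, zpow_natCast, ← div_eq_inv_mul] at hu₂
    have e₁ := wpQuot_eq_qPoch (A := q ^ r) (Q := q ^ d) (b := c i * q ^ (r + n))
      (mul_ne_zero hci (zpow_ne_zero _ hq)) k
    have e₂ := wpQuot_eq_qPoch (A := q ^ r) (Q := q ^ d) (b := (c i)⁻¹ * q ^ r)
      (mul_ne_zero (inv_ne_zero hci) (zpow_ne_zero _ hq)) k
    have f₁ : q ^ r * q ^ d / (c i * q ^ (r + n)) = q ^ (-n : ℤ) * q ^ d / c i := by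
      rw [hrn, hwQ]; field_simp
    have f₂ : q ^ r * q ^ d / ((c i)⁻¹ * q ^ r) = c i * q ^ d := by
      have := zpow_ne_zero r hq
      field_simp
    have g₁ := qPoch_mul_qPoch_comm (c i * q ^ d) (q ^ d) k j
    have g₂ := qPoch_mul_qPoch_comm (q ^ (-n : ℤ) * q ^ d / c i) (q ^ d) k j
    rw [show c i * q ^ d * (q ^ d) ^ j = c i * q ^ (r + n) by rw [hrn]; ring] at g₁
    rw [show q ^ (-n : ℤ) * q ^ d / c i * (q ^ d) ^ j = (c i)⁻¹ * q ^ r by rw [hwQ]; ring] at g₂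
    rw [f₁, eq_div_iff hu₂] at e₁
    rw [f₂, eq_div_iff hu₁] at e₂
    have e3 : ((q ^ d) ^ (j + 1) * q ^ r) ^ k = (c i * q ^ (r + n)) ^ k * ((c i)⁻¹ * q ^ r) ^ k := by
      rw [← mul_pow, hrn]; congr 1; field_simp
    rw [e3]
    refine mul_right_cancel₀ (mul_ne_zero hu₁ hu₂) ?_
    calc _ = (qPoch (c i * q ^ d) (q ^ d) j * qPoch (q ^ (-n : ℤ) * q ^ d / c i) (q ^ d) j)
          * (wpQuot (q ^ r) (q ^ d) (c i * q ^ (r + n)) k * (c i * q ^ (r + n)) ^ k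
            * qPoch (q ^ (-n : ℤ) * q ^ d / c i) (q ^ d) k)
          * (wpQuot (q ^ r) (q ^ d) ((c i)⁻¹ * q ^ r) k * ((c i)⁻¹ * q ^ r) ^ k
            * qPoch (c i * q ^ d) (q ^ d) k) := by ring
      _ = (qPoch (c i * q ^ d) (q ^ d) j * qPoch (c i * q ^ (r + n)) (q ^ d) k)
          * (qPoch (q ^ (-n : ℤ) * q ^ d / c i) (q ^ d) j
            * qPoch ((c i)⁻¹ * q ^ r) (q ^ d) k) := by rw [e₁, e₂]; ring
      _ = _ := by rw [← g₁, ← g₂]; ring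
  rw [wpTerm, wpPoly, Fintype.prod_sum_type, zpow_natCast]
  simp only [← hpair, wpParams, Sum.elim_inl, Sum.elim_inr]
  simp only [Finset.prod_mul_distrib, Finset.prod_const, Finset.card_univ, Fintype.card_fin]
  rw [wpCoef, eq_div_iff (pow_ne_zero _ (pow_ne_zero _ hQ))]
  have e4 : ((q ^ r) ^ 3 * (q ^ d) ^ 2) ^ k * ((q ^ d) ^ k) ^ (3 * j + 1)
      = (((q ^ d) ^ (j + 1) * q ^ r) ^ k) ^ 3 := by
    generalize q ^ r = x, q ^ d = y
    ring
  rw [← e4, pow_mul' (q ^ d) 2 k]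
  ring

/-- The series vanishes modulo `(1 - q ^ n) ^ 2`, for both ranges of summation. -/
theorem sum_wpTerm_mem_sq (h : IsCycloSubring O n q) (hnd : IsCoprime (n : ℤ) d)
    (hc : ∀ i, IsParam O q (c i)) {i₀ : Fin 3} (hi₀ : c i₀ = 1)
    (hdj : (d : ℤ) * (j + 1) = n + r) (hj : 3 * j + 1 < n) {N : ℕ} (hN : N = n - j ∨ N = n) :
    ∑ k ∈ Finset.range N, wpTerm (q ^ r) (q ^ d) (wpParams q c r r) k
      ∈ multiplesIn O ((1 - q ^ n) * (1 - q ^ n)) := by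
  obtain ⟨M, rfl⟩ : ∃ M, n = M + 1 + j := ⟨n - j - 1, by omega⟩
  set n := M + 1 + j with hn
  have hrM : (n : ℤ) ∣ r + d * M := ⟨d - 1, by
    have : (M : ℤ) = n - (j + 1) := by omega
    rw [this]; linear_combination -hdj⟩
  have htail : ∀ u : ℤ, (n : ℤ) ∣ u - r →
      ∑ k ∈ Finset.Ico (M + 1) n, wpTerm (q ^ r) (q ^ d) (wpParams q c r u) k
      ∈ multiplesIn O ((1 - q ^ n) * (1 - q ^ n)) := fun u hu => sum_mem fun k hk => by
    rw [Finset.mem_Ico] at hk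
    exact h.wpTerm_mem_multiplesIn hnd hc hi₀ hu hrM hk.1 hk.2
  have hru : (n : ℤ) ∣ r + n - r := by simp
  have hdef : ∑ k ∈ Finset.range n, wpTerm (q ^ r) (q ^ d) (wpParams q c r (r + n)) k
      ∈ multiplesIn O ((1 - q ^ n) * (1 - q ^ n)) := by
    have hu : ∏ i, (qPoch (c i * q ^ d) (q ^ d) j * qPoch (q ^ (-n : ℤ) * q ^ d / c i) (q ^ d) j)
        ∈ unitsIn O := prod_mem fun i _ => by
      have hu₁ := h.qPoch_mem_unitsIn hnd (hc i) (e := d) (by simp) (show j < n by omega)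
      have hu₂ := h.qPoch_mem_unitsIn hnd ((hc i).inv h.q_mem) (e := -n + d) (by simp)
        (show j < n by omega)
      rw [zpow_natCast] at hu₁
      rw [zpow_add₀ h.q_mem.2.2, zpow_natCast, ← div_eq_inv_mul] at hu₂
      exact mul_mem hu₁ hu₂
    refine mem_multiplesIn_of_mul_mem hu ?_
    rw [Finset.mul_sum, Finset.sum_congr rfl fun k hk =>
      h.wpTerm_eq_wpPoly hnd hc hdj (Finset.mem_range.mp hk)]
    exact h.sum_wpPoly_mem hnd hc hi₀ hdj hj
  -- The deformation may be undone only on the range symmetric under reflection, so the tail beyond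
  -- M is removed first and restored afterwards.
  rw [← Finset.sum_range_add_sum_Ico _ (show M + 1 ≤ n by omega)] at hdef
  have h1 := (add_mem_cancel_right (htail _ hru)).mp hdef
  have h2 := h.sum_wpTerm_sub_mem hnd hc hru (by omega) hrM
  have h3 := (sub_add_cancel _ (_ : F)) ▸ add_mem h2 h1
  rcases hN with rfl | rfl
  · rwa [show n - j = M + 1 by omega]
  · rw [← Finset.sum_range_add_sum_Ico _ (show M + 1 ≤ n by omega)]
    exact add_mem h3 (htail r (by simp))

end IsCycloSubring

end Deformed

/-! ### Rational functions with denominator coprime to P -/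

section Localization

variable {K : Type*} [Field K]

/-- The subring of rational functions that have a denominator coprime to `P`. -/
def coprimeDenomSubring (P : K[X]) : Subring (RatFunc K) where
  carrier := {f | ∃ N D : K[X], IsCoprime P D ∧ D ≠ 0 ∧
    f = algebraMap K[X] (RatFunc K) N / algebraMap K[X] (RatFunc K) D}
  zero_mem' := ⟨0, 1, isCoprime_one_right, one_ne_zero, by simp⟩
  one_mem' := ⟨1, 1, isCoprime_one_right, one_ne_zero, by simp⟩
  add_mem' := by
    rintro _ _ ⟨N, D, h, h0, rfl⟩ ⟨N', D', h', h0', rfl⟩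
    refine ⟨N * D' + D * N', D * D', h.mul_right h', mul_ne_zero h0 h0', ?_⟩
    rw [div_add_div _ _ (RatFunc.algebraMap_ne_zero h0) (RatFunc.algebraMap_ne_zero h0')]
    simp only [map_add, map_mul]
  neg_mem' := by
    rintro _ ⟨N, D, h, h0, rfl⟩
    exact ⟨-N, D, h, h0, by rw [map_neg, neg_div]⟩
  mul_mem' := by
    rintro _ _ ⟨N, D, h, h0, rfl⟩ ⟨N', D', h', h0', rfl⟩
    exact ⟨N * N', D * D', h.mul_right h', mul_ne_zero h0 h0', by
      rw [map_mul, map_mul, div_mul_div_comm]⟩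

variable {P : K[X]}

theorem algebraMap_mem_unitsIn {D : K[X]} (hD : IsCoprime P D) (hD0 : D ≠ 0) :
    algebraMap K[X] (RatFunc K) D ∈ unitsIn (coprimeDenomSubring P) :=
  ⟨⟨D, 1, isCoprime_one_right, one_ne_zero, by simp⟩, ⟨1, D, hD, hD0, by simp⟩,
    RatFunc.algebraMap_ne_zero hD0⟩

/-- A rational function that is a multiple of `E` up to a denominator coprime to `P`
has numerator divisible by any divisor of `E` that is a power of `P`. -/
theorem dvd_num_of_mem_multiplesIn {E : K[X]} {f : RatFunc K} (e : ℕ) (hE : P ^ e ∣ E)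
    (hf : f ∈ multiplesIn (coprimeDenomSubring P) (algebraMap K[X] (RatFunc K) E)) :
    P ^ e ∣ f.num := by
  obtain ⟨_, ⟨N, D, h, h0, rfl⟩, rfl⟩ := hf
  have := (ratCongr_zero_iff (P ^ e) (E * N) D h0 h.pow_left).mpr (hE.mul_right N)
  rwa [RatCongr, sub_zero, map_mul, mul_div_assoc] at this

theorem ratFuncX_pow_ne_one {m : ℕ} (hm : 0 < m) : (RatFunc.X : RatFunc K) ^ m ≠ 1 := by
  rw [← RatFunc.algebraMap_X, ← map_pow, ← map_one (algebraMap K[X] (RatFunc K))]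
  intro h
  have := congrArg Polynomial.natDegree (RatFunc.algebraMap_injective K h)
  simp at this
  omega

end Localization

/-! ### The localization at a cyclotomic polynomial -/

section CyclotomicLocalization

variable {K : Type*} [Field K] [CharZero K] {m : ℕ}

theorem isCoprime_cyclotomic_of_aeval_ne_zero (hm : 0 < m) {D : K[X]}
    (h : ∀ ζ : AlgebraicClosure K, IsPrimitiveRoot ζ m → Polynomial.aeval ζ D ≠ 0) :
    IsCoprime (Polynomial.cyclotomic m K) D := by
  refine (Polynomial.isCoprime_iff_aeval_ne_zero_of_isAlgClosed K (AlgebraicClosure K) _ _).mpr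
    fun ζ => or_iff_not_imp_left.mpr fun hζ => h ζ ?_
  rw [not_not, Polynomial.aeval_def, Polynomial.eval₂_eq_eval_map, Polynomial.map_cyclotomic] at hζ
  exact (Polynomial.isRoot_cyclotomic_iff_charZero hm).mp hζ

theorem algebraMap_mem_unitsIn_cyclotomic (hm : 0 < m) {D : K[X]}
    (h : ∀ ζ : AlgebraicClosure K, IsPrimitiveRoot ζ m → Polynomial.aeval ζ D ≠ 0) :
    algebraMap K[X] (RatFunc K) D
      ∈ unitsIn (coprimeDenomSubring (Polynomial.cyclotomic m K)) := by
  refine algebraMap_mem_unitsIn (isCoprime_cyclotomic_of_aeval_ne_zero hm h) ?_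
  rintro rfl
  have : NeZero (m : AlgebraicClosure K) := ⟨by exact_mod_cast hm.ne'⟩
  obtain ⟨ζ, hζ⟩ := IsAlgClosed.exists_aeval_eq_zero (AlgebraicClosure K)
    (Polynomial.cyclotomic m K) (by
      rw [Polynomial.degree_cyclotomic]
      exact_mod_cast (Nat.totient_pos.mpr hm).ne')
  rw [Polynomial.aeval_def, Polynomial.eval₂_eq_eval_map, Polynomial.map_cyclotomic] at hζ
  exact h ζ ((Polynomial.isRoot_cyclotomic_iff_charZero hm).mp hζ) (by simp)

theorem ratFuncX_mem_unitsIn (hm : 0 < m) :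
    (RatFunc.X : RatFunc K) ∈ unitsIn (coprimeDenomSubring (Polynomial.cyclotomic m K)) := by
  rw [← RatFunc.algebraMap_X]
  refine algebraMap_mem_unitsIn_cyclotomic hm fun ζ hζ => ?_
  rw [Polynomial.aeval_X]
  exact hζ.ne_zero hm.ne'

theorem ratFuncC_mem_unitsIn (hm : 0 < m) {c : K} (hc : c ≠ 0) :
    (RatFunc.C c : RatFunc K) ∈ unitsIn (coprimeDenomSubring (Polynomial.cyclotomic m K)) := by
  rw [← RatFunc.algebraMap_C]
  refine algebraMap_mem_unitsIn_cyclotomic hm fun ζ hζ => ?_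
  rw [Polynomial.aeval_C]
  simpa using hc

theorem one_sub_C_mul_zpow_mem_unitsIn (hm : 0 < m) {c : K} (e : ℤ)
    (hc : ∀ ζ : AlgebraicClosure K, IsPrimitiveRoot ζ m →
      algebraMap K (AlgebraicClosure K) c * ζ ^ e ≠ 1) :
    1 - RatFunc.C c * (RatFunc.X : RatFunc K) ^ e
      ∈ unitsIn (coprimeDenomSubring (Polynomial.cyclotomic m K)) := by
  rcases Int.eq_nat_or_neg e with ⟨k, rfl | rfl⟩
  · have := algebraMap_mem_unitsIn_cyclotomic (K := K) hm
      (D := 1 - Polynomial.C c * Polynomial.X ^ k) fun ζ hζ => by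
        have := hc ζ hζ
        rw [zpow_natCast] at this
        simpa [sub_eq_zero] using this.symm
    simpa using this
  · have := algebraMap_mem_unitsIn_cyclotomic (K := K) hm
      (D := Polynomial.X ^ k - Polynomial.C c) fun ζ hζ => by
        have := hc ζ hζ
        rw [zpow_neg, zpow_natCast, ← div_eq_mul_inv, Ne,
          div_eq_one_iff_eq (pow_ne_zero _ (hζ.ne_zero hm.ne'))] at this
        simpa [sub_eq_zero] using Ne.symm this
    have h1 := div_mem_unitsIn this (pow_mem (ratFuncX_mem_unitsIn hm) k)
    have hX : (RatFunc.X : RatFunc K) ^ k ≠ 0 := pow_ne_zero _ RatFunc.X_ne_zero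
    rw [zpow_neg, zpow_natCast]
    rw [map_sub, map_pow, RatFunc.algebraMap_X, RatFunc.algebraMap_C, sub_div, div_self hX,
      div_eq_mul_inv] at h1
    exact h1

theorem isCycloSubring_cyclotomic (hm : 0 < m) :
    IsCycloSubring (coprimeDenomSubring (Polynomial.cyclotomic m K)) m
      (RatFunc.X : RatFunc K) where
  q_mem := ratFuncX_mem_unitsIn hm
  one_sub e he := by
    have := one_sub_C_mul_zpow_mem_unitsIn (K := K) hm (c := 1) e fun ζ hζ h => he <| by
      rw [map_one, one_mul] at h
      exact (hζ.zpow_eq_one_iff_dvd e).mp h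
    simpa using this
  geom t ht := by
    have := algebraMap_mem_unitsIn_cyclotomic (K := K) hm
      (D := ∑ i ∈ Finset.range t, (Polynomial.X ^ m) ^ i) fun ζ hζ => by
        -- At ζ every summand equals 1, so the sum is t, nonzero in characteristic zero.
        simp [hζ.pow_eq_one, ht.ne']
    simpa using this
  ne_one := ratFuncX_pow_ne_one hm
  two_mem := by
    have := ratFuncC_mem_unitsIn (K := K) hm (c := 2) two_ne_zero
    rwa [map_ofNat] at this

/-- Raising c ζ^e = 1 to the m-th power would give c^m = 1. -/
theorem isParam_C (hm : 0 < m) {c : K} (hc0 : c ≠ 0) (hc : c ^ m ≠ 1) :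
    IsParam (coprimeDenomSubring (Polynomial.cyclotomic m K)) (RatFunc.X : RatFunc K)
      (RatFunc.C c) where
  mem := ratFuncC_mem_unitsIn hm hc0
  generic := Or.inr fun e => one_sub_C_mul_zpow_mem_unitsIn hm e fun ζ hζ h => hc <| by
    have h1 := congrArg (· ^ m) h
    simp only [mul_pow, one_pow] at h1
    rw [← zpow_natCast (ζ ^ e), zpow_comm, zpow_natCast, hζ.pow_eq_one, one_zpow, mul_one,
      ← map_pow] at h1
    exact (algebraMap K (AlgebraicClosure K)).injective (by rw [h1, map_one])

theorem isCoprime_cyclotomic {n m : ℕ} (h : n ≠ m) :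
    IsCoprime (Polynomial.cyclotomic n K) (Polynomial.cyclotomic m K) := by
  have := (Polynomial.cyclotomic.isCoprime_rat h).map (Polynomial.mapRingHom (algebraMap ℚ K))
  simpa using this

/-- Divisibility by `[n] Φ_n(q)` can be checked one cyclotomic factor at a time. -/
theorem qIntPoly_mul_cyclotomic_dvd {n : ℕ} (hn : 1 < n) {N : K[X]}
    (h : ∀ m, 1 < m → m ∣ n → m < n → Polynomial.cyclotomic m K ∣ N)
    (hsq : Polynomial.cyclotomic n K ^ 2 ∣ N) :
    qIntPoly K n * Polynomial.cyclotomic n K ∣ N := by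
  have hmem : n ∈ n.divisors.erase 1 := by simp; omega
  have e : qIntPoly K n * Polynomial.cyclotomic n K
      = ∏ m ∈ n.divisors.erase 1, Polynomial.cyclotomic m K ^ (if m = n then 2 else 1) := by
    rw [qIntPoly, ← Polynomial.prod_cyclotomic_eq_geom_sum (by omega),
      ← Finset.mul_prod_erase _ _ hmem, ← Finset.mul_prod_erase _ _ hmem, if_pos rfl,
      mul_right_comm, sq]
    congr 1
    refine Finset.prod_congr rfl fun m hm => ?_
    rw [if_neg (Finset.ne_of_mem_erase hm), pow_one]
  rw [e]
  refine Finset.prod_dvd_of_coprime (fun a _ b _ hab => (isCoprime_cyclotomic hab).pow)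
    fun m hm => ?_
  rw [Finset.mem_erase, Nat.mem_divisors] at hm
  split_ifs with hmn
  · rwa [hmn]
  · rw [pow_one]
    have := Nat.le_of_dvd (by omega) hm.2.1
    exact h m (by have := Nat.pos_of_dvd_of_pos hm.2.1 (by omega); omega) hm.2.1 (by omega)

end CyclotomicLocalization

/-! ### The series as a well-poised sum, and the conclusion -/

section Series

/-- The terms of the series in terms of `wpTerm`. -/
theorem qPochs_term_eq {F : Type*} [Field F] {q a b : F} (hq : q ≠ 0) (ha : a ≠ 0) (hb : b ≠ 0)
    (r : ℤ) (d k : ℕ) :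
    qInt q (2 * d * k + r)
        * (qPochs [a * q ^ r, q ^ r / a, b * q ^ r, q ^ r / b, q ^ r, q ^ r] (q ^ d) k
          / qPochs [a * q ^ d, q ^ d / a, b * q ^ d, q ^ d / b, q ^ d, q ^ d] (q ^ d) k)
        * q ^ ((2 * (d : ℤ) - 3 * r) * (k : ℤ))
      = (1 - q)⁻¹ * wpTerm (q ^ r) (q ^ d) (wpParams q ![a, b, 1] r r) k := by
  have hqr := zpow_ne_zero r hq
  have hpair : ∀ c : F, c ≠ 0 →
      qPoch (c * q ^ r) (q ^ d) k * qPoch (q ^ r / c) (q ^ d) k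
        / (qPoch (c * q ^ d) (q ^ d) k * qPoch (q ^ d / c) (q ^ d) k)
      = wpQuot (q ^ r) (q ^ d) (c * q ^ r) k * wpQuot (q ^ r) (q ^ d) (c⁻¹ * q ^ r) k
        * ((q ^ r) ^ 2) ^ k := by
    intro c hc
    have e₁ := wpQuot_eq_qPoch (A := q ^ r) (Q := q ^ d) (mul_ne_zero hc hqr) k
    have e₂ := wpQuot_eq_qPoch (A := q ^ r) (Q := q ^ d) (mul_ne_zero (inv_ne_zero hc) hqr) k
    rw [show q ^ r * q ^ d / (c * q ^ r) = q ^ d / c by field_simp] at e₁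
    rw [show q ^ r * q ^ d / (c⁻¹ * q ^ r) = c * q ^ d by field_simp] at e₂
    rw [mul_comm (qPoch (c * q ^ d) _ _), mul_div_mul_comm, ← e₁,
      show q ^ r / c = c⁻¹ * q ^ r by ring, ← e₂,
      show (q ^ r) ^ 2 = (c * q ^ r) * (c⁻¹ * q ^ r) by field_simp, mul_pow]
    ring
  have h1 := hpair a ha
  have h2 := hpair b hb
  have h3 := hpair 1 one_ne_zero
  simp only [one_mul, div_one, inv_one] at h3
  have e1 : q ^ (2 * (d : ℤ) * k + r) = q ^ r * (q ^ d) ^ (2 * k) := by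
    rw [← pow_mul, ← zpow_natCast q (d * _), ← zpow_add₀ hq]; congr 1; push_cast; ring
  have e2 : q ^ ((2 * (d : ℤ) - 3 * r) * (k : ℤ)) * (((q ^ r) ^ 2) ^ k) ^ 3
      = ((q ^ r) ^ 3 * (q ^ d) ^ 2) ^ k := by
    simp only [← zpow_natCast, ← zpow_mul, ← zpow_add₀ hq]
    congr 1; push_cast; ring
  have e3 : qPochs [a * q ^ r, q ^ r / a, b * q ^ r, q ^ r / b, q ^ r, q ^ r] (q ^ d) k
          / qPochs [a * q ^ d, q ^ d / a, b * q ^ d, q ^ d / b, q ^ d, q ^ d] (q ^ d) k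
      = (qPoch (a * q ^ r) (q ^ d) k * qPoch (q ^ r / a) (q ^ d) k
        / (qPoch (a * q ^ d) (q ^ d) k * qPoch (q ^ d / a) (q ^ d) k))
      * (qPoch (b * q ^ r) (q ^ d) k * qPoch (q ^ r / b) (q ^ d) k
        / (qPoch (b * q ^ d) (q ^ d) k * qPoch (q ^ d / b) (q ^ d) k))
      * (qPoch (q ^ r) (q ^ d) k * qPoch (q ^ r) (q ^ d) k
        / (qPoch (q ^ d) (q ^ d) k * qPoch (q ^ d) (q ^ d) k)) := by
    rw [div_mul_div_comm, div_mul_div_comm]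
    simp [qPochs, mul_assoc]
  rw [e3, h1, h2, h3, qInt, e1, wpTerm, wpCoef, Fintype.prod_sum_type, Fin.prod_univ_three,
    Fin.prod_univ_three, ← e2]
  simp [wpParams]
  ring

theorem indeterminate_pow_ne_one (i : Fin 2) {m : ℕ} (hm : 0 < m) :
    algebraMap (MvPolynomial (Fin 2) ℚ) CoeffField (MvPolynomial.X i) ≠ 0 ∧
      algebraMap (MvPolynomial (Fin 2) ℚ) CoeffField (MvPolynomial.X i) ^ m ≠ 1 := by
  have hinj := IsFractionRing.injective (MvPolynomial (Fin 2) ℚ) CoeffField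
  refine ⟨fun h => MvPolynomial.X_ne_zero i (hinj (by rw [h, map_zero])), fun h => ?_⟩
  rw [← map_pow, ← map_one (algebraMap (MvPolynomial (Fin 2) ℚ) CoeffField)] at h
  have := congrArg (MvPolynomial.eval fun _ => (0 : ℚ)) (hinj h)
  simp [hm.ne'] at this

end Series

open RatField in
theorem theorem2p3 (r : ℤ) (hr : r = 1 ∨ r = -1) (d n : ℕ) (hd : 3 ≤ d) (hn : 1 < n)
    (hgcd : Nat.gcd n d = 1) (hmod : (n : ℤ) ≡ -r [ZMOD (d : ℤ)])
    (M : ℕ) (hM : (d : ℤ) * (M : ℤ) = (d : ℤ) * n - n - r ∨ M = n - 1) :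
    RatCongr (qIntPoly CoeffField n * Polynomial.cyclotomic n CoeffField)
      (∑ k ∈ Finset.range (M + 1),
        qInt q (2 * d * k + r)
          * (qPochs [a * q ^ r, q ^ r / a, b * q ^ r, q ^ r / b, q ^ r, q ^ r] (q ^ d) k
            / qPochs [a * q ^ d, q ^ d / a, b * q ^ d, q ^ d / b, q ^ d, q ^ d] (q ^ d) k)
          * q ^ ((2 * (d : ℤ) - 3 * r) * (k : ℤ)))
      0 := by
  have hq : q ≠ 0 := RatFunc.X_ne_zero
  have hparam : ∀ m, 0 < m → ∀ i, IsParam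
      (coprimeDenomSubring (Polynomial.cyclotomic m CoeffField)) q (![a, b, 1] i) := by
    intro m hm i
    fin_cases i
    · exact isParam_C hm (indeterminate_pow_ne_one 0 hm).1 (indeterminate_pow_ne_one 0 hm).2
    · exact isParam_C hm (indeterminate_pow_ne_one 1 hm).1 (indeterminate_pow_ne_one 1 hm).2
    · exact IsParam.one
  have ha : a ≠ 0 := ((hparam 1 one_pos) 0).mem.2.2
  have hb : b ≠ 0 := ((hparam 1 one_pos) 1).mem.2.2
  obtain ⟨J, hJ⟩ : (d : ℤ) ∣ n + r := by
    have := hmod.symm.dvd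
    rwa [sub_neg_eq_add] at this
  have hJ1 : 1 ≤ J := by
    by_contra hJ0
    have : (d : ℤ) * J ≤ 0 := mul_nonpos_of_nonneg_of_nonpos (by omega) (by omega)
    omega
  -- With d(j+1) = n + r, the first choice of M is n - 1 - j.
  obtain ⟨j, rfl⟩ : ∃ j : ℕ, J = j + 1 := ⟨(J - 1).toNat, by omega⟩
  -- From d ≥ 3: 3(j+1) ≤ n + r ≤ n + 1.
  have hj : 3 * j + 1 < n := by
    have : (3 : ℤ) * (j + 1) ≤ d * (j + 1) := mul_le_mul_of_nonneg_right (by omega) (by omega)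
    omega
  have hM' : M + 1 = n - j ∨ M + 1 = n := by
    refine hM.imp (fun h => ?_) fun h => by omega
    have : (d : ℤ) * (M + 1) = d * (n - j) := by linear_combination h - hJ
    have := mul_left_cancel₀ (by omega : (d : ℤ) ≠ 0) this
    omega
  rw [RatCongr, sub_zero, Finset.sum_congr rfl fun k _ => qPochs_term_eq hq ha hb r d k,
    ← Finset.mul_sum]
  have hφ : ∀ m, 1 - q ^ m = algebraMap CoeffField[X] RatField (1 - Polynomial.X ^ m) := by
    intro m; simp [q]
  have hdvd : ∀ m, 0 < m → Polynomial.cyclotomic m CoeffField ∣ 1 - Polynomial.X ^ m := by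
    intro m hm
    rw [← neg_sub, dvd_neg]
    exact Polynomial.cyclotomic.dvd_X_pow_sub_one m _
  have hq1 : ∀ m, 1 < m →
      (1 - q)⁻¹ ∈ coprimeDenomSubring (Polynomial.cyclotomic m CoeffField) := by
    intro m hm
    have := ((isCycloSubring_cyclotomic (K := CoeffField) (m := m) (by omega)).one_sub 1
      (by simp [Int.natCast_dvd]; omega)).2.1
    rwa [zpow_one] at this
  have hnd : IsCoprime (n : ℤ) d := Nat.isCoprime_iff_coprime.mpr hgcd
  refine qIntPoly_mul_cyclotomic_dvd hn (fun m hm hmn hlt => ?_) ?_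
  · have hcyc := isCycloSubring_cyclotomic (K := CoeffField) (m := m) (by omega)
    have hmn' : (m : ℤ) ∣ n := by exact_mod_cast hmn
    -- The centre of reflection for m is the residue of n - j - 1, since r + d(n - j - 1) = n(d - 1)
    -- is a multiple of m.
    have hrM : (m : ℤ) ∣ r + d * ((n - j - 1) % m : ℕ) := by
      have e : ((n - j - 1 : ℕ) : ℤ) = n - j - 1 := by omega
      have h1 : (m : ℤ) ∣ r + d * (n - j - 1 : ℕ) := by
        rw [e, show r + (d : ℤ) * (n - j - 1) = n * (d - 1) by linear_combination hJ]
        exact hmn'.mul_right _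
      have h2 : r + (d : ℤ) * ((n - j - 1) % m : ℕ)
          = r + d * (n - j - 1 : ℕ) - m * (d * ((n - j - 1) / m : ℕ)) := by
        have := Nat.div_add_mod (n - j - 1) m
        have : ((n - j - 1 : ℕ) : ℤ) = m * ((n - j - 1) / m : ℕ) + ((n - j - 1) % m : ℕ) := by
          exact_mod_cast this.symm
        rw [this]; ring
      rw [h2]
      exact dvd_sub h1 (Dvd.intro _ rfl)
    -- The range of summation is a number of full periods, followed either by nothing or by one
    -- stretch that the reflection preserves.
    obtain ⟨l, N, hlN, hN⟩ : ∃ l N, M + 1 = l * m + N ∧ (N = 0 ∨ N = (n - j - 1) % m + 1) := by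
      rcases hM' with h | h
      · refine ⟨(n - j - 1) / m, _, ?_, Or.inr rfl⟩
        rw [h, ← add_assoc, Nat.div_add_mod']
        omega
      · exact ⟨n / m, 0, by rw [h, add_zero, Nat.div_mul_cancel hmn], Or.inl rfl⟩
    rw [← pow_one (Polynomial.cyclotomic m CoeffField)]
    refine dvd_num_of_mem_multiplesIn (E := 1 - Polynomial.X ^ m) 1 (by rw [pow_one]; exact hdvd m (by omega))
      (multiplesIn_mul_left ?_ (hq1 m hm))
    rw [← hφ, hlN]
    exact hcyc.sum_wpTerm_periods_mem (hnd.of_isCoprime_of_dvd_left hmn') (by omega)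
      (Nat.mod_lt _ (by omega)) hrM (hparam m (by omega)) (i₀ := 2) rfl l hN
  · have hcyc := isCycloSubring_cyclotomic (K := CoeffField) (m := n) (by omega)
    refine dvd_num_of_mem_multiplesIn 2 (pow_dvd_pow_of_dvd (hdvd n (by omega)) 2)
      (multiplesIn_mul_left ?_ (hq1 n hn))
    rw [map_pow, ← hφ, sq]
    exact hcyc.sum_wpTerm_mem_sq hnd (hparam n (by omega)) (i₀ := 2) rfl hJ.symm hj hM'
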